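/- Let $\mathcal M=(\mathcal M,\otimes,I)$ be a small strict monoidal category. Then the category $\mathbf{GS}_{\mathcal M}$ of $\mathcal M$-graded algebraic theories and the category $\mathbf{GLaw}_{\mathcal M}$ of $\mathcal M$-graded Lawvere theories are equivalent. These categories are defined as follows. **Graded algebraic theories.** A signature is a family of sets $\Sigma=(\Sigma_{n,m})_{n\in\mathbb N,\,m\in\mathcal M}$. The sets $T^\Sigma_m(X)$ of terms of grade $m$ in variables $X$ are generated inductively by: $x\in T^\Sigma_I(X)$ for $x\in X$; $c_w(t)\in T^\Sigma_{m'}(X)$ for $t\in T^\Sigma_m(X)$ and $w:m\to m'$ in $\mathcal M$; $f(t_1,\dots,t_n)\in T^\Sigma_{m\otimes m'}(X)$ for $f\in\Sigma_{n,m}$ and $t_1,\dots,t_n\in T^\Sigma_{m'}(X)$. Substituting terms of grade $m'$ for the variables of a term of grade $m$ gives a term of grade $m\otimes m'$, with $c_w(s)[\sigma]=c_{w\otimes m'}(s[\sigma])$. A theory is a pair $\mathcal T=(\Sigma,E)$ where $E$ is a family of sets $E_{n,m}$ of pairs of elements of $T^\Sigma_m(\{x_1,\dots,x_n\})$. Provable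 equality $\mathcal T\vdash s=t$ is generated by reflexivity, symmetry, transitivity, congruence for operations and for coercions $c_w$, substitution, the axioms $E$, and $$c_{1_m}(t)=t,\qquad c_{w'}(c_w(t))=c_{w'\circ w}(t),\qquad f(c_w(t_1),\dots,c_w(t_n))=c_{m\otimes w}(f(t_1,\dots,t_n))\quad(f\in\Sigma_{n,m}).$$ Let $F_{\mathcal T}X:\mathcal M\to\mathbf{Set}$ be the functor $m\mapsto T^\Sigma_m(X)/{\vdash}$, $F_{\mathcal T}X(w)[t]=[c_w(t)]$. A model of $\mathcal T$ in $[\mathcal M,\mathbf{Set}]$ is a functor $A:\mathcal M\to\mathbf{Set}$ with a natural transformation $A^n\to A(m\otimes -)$ for each $f\in\Sigma_{n,m}$ such that, for the induced interpretation $|s|^A:A^n\to A(m\otimes-)$ of terms $s\in T^\Sigma_m(\{x_1,\dots,x_n\})$, one has $|s|^A=|t|^A$ whenever $(s,t)\in E_{n,m}$; $F_{\mathcal T}X$ with $f([t_1],\dots,[t_n])=[f(t_1,\dots,t_n)]$ is such a model. A morphism $\alpha:\mathcal T\to\mathcal T'$ in $\mathbf{GS}_{\mathcal M}$ is a family of functions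 $\Sigma_{n,m}\to F_{\mathcal T'}\{x_1,\dots,x_n\}(m)$ such that interpreting each $f$ by the class of terms $\alpha(f)$ makes the free models $F_{\mathcal T'}\{x_1,\dots,x_k\}$, $k\in\mathbb N$, into models of $\mathcal T$. The identity sends $f$ to $[f(x_1,\dots,x_n)]$, and $(\beta\circ\alpha)(f)=F_\beta(\alpha(f))$, where $F_\beta[t]$ is the interpretation of $t$ under $\beta$ at the generic variables $x_1,\dots,x_n$. **Graded Lawvere theories.** Equip $[\mathcal M,\mathbf{Set}]$ with the Day convolution. Explicitly, an $[\mathcal M,\mathbf{Set}]$-category $\mathcal A$ has hom-functors $\mathcal A(X,Y):\mathcal M\to\mathbf{Set}$, identities $1_X\in\mathcal A(X,X)I$ and associative, unital compositions $\mathcal A(Y,Z)m_1\times\mathcal A(X,Y)m_2\to\mathcal A(X,Z)(m_1\otimes m_2)$ natural in $m_1,m_2$; an $[\mathcal M,\mathbf{Set}]$-functor consists of a map on objects and natural transformations on hom-functors that preserve identities and composition. For $n\in\mathbb N$ let $\underline n=n\cdot\mathcal M(I,-)$ be the $n$-fold coproduct of the functor represented by $I$. Let $N_{\mathcal M}$ be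 the $[\mathcal M,\mathbf{Set}]$-category with objects $\underline n$ (identified with $n\in\mathbb N$) and $N_{\mathcal M}(\underline n,\underline{n'})m=\mathrm{Nat}(\underline{n'},\underline n(-\otimes m))$. An $N_{\mathcal M}$-cotensor of an object $C$ of $\mathcal A$ by $\underline n$ is an object $P$ with a natural transformation $\nu:\underline n\to\mathcal A(P,C)$ such that for all $B$ and $m$ the map $\mathcal A(B,P)m\to\mathrm{Nat}(\underline n,\mathcal A(B,C)(-\otimes m))$, $f\mapsto(x\mapsto\nu(x)\circ f)$, is bijective; a functor preserves it if it sends $\nu$ to a natural transformation with the same property. A graded Lawvere theory is a pair $(\mathcal L,J)$ of an $[\mathcal M,\mathbf{Set}]$-category $\mathcal L$ that has all $N_{\mathcal M}$-cotensors and an identity-on-objects, $N_{\mathcal M}$-cotensor preserving $[\mathcal M,\mathbf{Set}]$-functor $J:N_{\mathcal M}\to\mathcal L$. A morphism $(\mathcal L,J)\to(\mathcal L',J')$ in $\mathbf{GLaw}_{\mathcal M}$ is an $[\mathcal M,\mathbf{Set}]$-functor $F:\mathcal L\to\mathcal L'$ with $FJ=J'$. -/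

import Mathlib

open CategoryTheory MonoidalCategory

universe v w u

namespace Graded

/-- A monoidal category is strict if its associator and unitors are identities. -/
class IsStrictMonoidal (M : Type u) [Category.{w} M] [MonoidalCategory M] : Prop where
  unit_tensor (m : M) : 𝟙_ M ⊗ m = m
  tensor_unit (m : M) : m ⊗ 𝟙_ M = m
  tensor_assoc (m₁ m₂ m₃ : M) : (m₁ ⊗ m₂) ⊗ m₃ = m₁ ⊗ (m₂ ⊗ m₃)
  leftUnitor_eq (m : M) : (λ_ m).hom = eqToHom (unit_tensor m)
  rightUnitor_eq (m : M) : (ρ_ m).hom = eqToHom (tensor_unit m)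
  associator_eq (m₁ m₂ m₃ : M) : (α_ m₁ m₂ m₃).hom = eqToHom (tensor_assoc m₁ m₂ m₃)

theorem eqToHom_unit_tensor {M : Type u} [Category.{w} M] [MonoidalCategory M]
    [IsStrictMonoidal M] (m : M) :
    eqToHom (IsStrictMonoidal.unit_tensor m).symm = (λ_ m).inv := by
  rw [← cancel_mono (λ_ m).hom, Iso.inv_hom_id, IsStrictMonoidal.leftUnitor_eq, eqToHom_trans,
    eqToHom_refl]

theorem eqToHom_tensor_assoc {M : Type u} [Category.{w} M] [MonoidalCategory M]
    [IsStrictMonoidal M] (m₁ m₂ m₃ : M) :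
    eqToHom (IsStrictMonoidal.tensor_assoc m₁ m₂ m₃).symm = (α_ m₁ m₂ m₃).inv := by
  rw [← cancel_mono (α_ m₁ m₂ m₃).hom, Iso.inv_hom_id, IsStrictMonoidal.associator_eq,
    eqToHom_trans, eqToHom_refl]

/-! ### Signatures and terms -/

/-- A signature: a set of operation symbols for each arity `n` and each grade `m`. -/
abbrev Signature (M : Type u) : Type (u + 1) := ℕ → M → Type u

/-- Graded terms with variables in `X`. -/
inductive Term {M : Type u} [SmallCategory M] [MonoidalCategory M] (S : Signature M)
    (X : Type w) : M → Type (max u w)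
  | var (x : X) : Term S X (𝟙_ M)
  | coe {m m' : M} (e : m ⟶ m') (t : Term S X m) : Term S X m'
  | op {n : ℕ} {m m' : M} (f : S n m) (t : Fin n → Term S X m') : Term S X (m ⊗ m')

namespace Term

variable {M : Type u} [SmallCategory M] [MonoidalCategory M] {S : Signature M}

/-- Transport of a term along an equality of grades. -/
def cast {X : Type w} {m m' : M} (h : m = m') (t : Term S X m) : Term S X m' := h ▸ t

/-- Renaming of variables. -/
def rename {X : Type v} {Y : Type w} (r : X → Y) : {m : M} → Term S X m → Term S Y m
  | _, var x => var (r x)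
  | _, coe e t => coe e (rename r t)
  | _, op f t => op f (fun i => rename r (t i))

/-- Substitution of terms of grade `k` for the variables of a term of grade `m`; the result has
grade `m ⊗ k`. -/
def subst [IsStrictMonoidal M] {X : Type v} {Y : Type w} {k : M} (σ : X → Term S Y k) :
    {m : M} → Term S X m → Term S Y (m ⊗ k)
  | _, var x => (σ x).cast (IsStrictMonoidal.unit_tensor k).symm
  | _, coe e t => coe (e ▷ k) (subst σ t)
  | _, op f t => (op f (fun i => subst σ (t i))).cast
      (IsStrictMonoidal.tensor_assoc _ _ _).symm

end Term

/-! ### Interpretation of terms in presheaves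

A presheaf here is a functor `A : M ⥤ Type v`. The strong action of `M` on presheaves is
`m ⊛ A = A (m ⊗ -)`, with unit and multiplication given by the (identity) coherence isomorphisms
of `M`. -/

/-- An interpretation of a signature in a presheaf `A`: for every operation `f` of arity `n` and
grade `m`, a natural transformation `A ^ n ⟶ A (m ⊗ -)`. -/
@[ext]
structure Interp {M : Type u} [SmallCategory M] [MonoidalCategory M] (S : Signature M)
    (A : M ⥤ Type v) where
  op {n : ℕ} {m : M} (f : S n m) {k : M} (a : Fin n → A.obj k) : A.obj (m ⊗ k)
  op_natural {n : ℕ} {m : M} (f : S n m) {k k' : M} (e : k ⟶ k') (a : Fin n → A.obj k) :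
    op f (fun i => A.map e (a i)) = A.map (m ◁ e) (op f a)

namespace Interp

variable {M : Type u} [SmallCategory M] [MonoidalCategory M] {S : Signature M}
  {A : M ⥤ Type v}

/-- The component at `k` of the interpretation `A ^ X ⟶ A (m ⊗ -)` of a term of grade `m` with
variables in `X`. -/
def eval (I : Interp S A) {X : Type w} {k : M} (a : X → A.obj k) :
    {m : M} → Term S X m → A.obj (m ⊗ k)
  | _, .var x => A.map (λ_ k).inv (a x)
  | _, .coe e t => A.map (e ▷ k) (I.eval a t)
  | _, .op f t => A.map (α_ _ _ k).inv (I.op f (fun i => I.eval a (t i)))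

theorem eval_natural (I : Interp S A) {X : Type w} {k k' : M} (e : k ⟶ k') (a : X → A.obj k)
    {m : M} (t : Term S X m) :
    I.eval (fun x => A.map e (a x)) t = A.map (m ◁ e) (I.eval a t) := by
  induction t with
  | var x =>
    simp only [eval, ← Functor.map_comp_apply]
    congr 2
    simp
  | coe e' t ih =>
    simp only [eval, ih, ← Functor.map_comp_apply]
    rw [whisker_exchange]
  | op f t ih =>
    simp only [eval, ih, op_natural, ← Functor.map_comp_apply]
    congr 2
    simp

theorem eval_cast (I : Interp S A) {X : Type w} {k : M} (a : X → A.obj k) {m m' : M}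
    (h : m = m') (t : Term S X m) : I.eval a (t.cast h) = A.map (eqToHom h ▷ k) (I.eval a t) := by
  subst h
  simp [Term.cast]

theorem eval_rename (I : Interp S A) {X : Type w} {Y : Type*} (r : X → Y) {k : M}
    (a : Y → A.obj k) {m : M} (t : Term S X m) :
    I.eval a (t.rename r) = I.eval (fun x => a (r x)) t := by
  induction t with
  | var x => rfl
  | coe e' t ih => simp only [eval, Term.rename, ih]
  | op f t ih => simp only [eval, Term.rename, ih]

theorem eval_subst [IsStrictMonoidal M] (I : Interp S A) {X : Type w} {Y : Type*} {j k : M}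
    (σ : X → Term S Y j) (a : Y → A.obj k) {m : M} (t : Term S X m) :
    I.eval a (t.subst σ) = A.map (α_ m j k).inv (I.eval (fun x => I.eval a (σ x)) t) := by
  induction t with
  | var x =>
    simp only [eval, Term.subst, eval_cast, ← Functor.map_comp_apply, eqToHom_unit_tensor]
    congr 2
    simp
  | coe e' t ih =>
    simp only [eval, Term.subst, ih, ← Functor.map_comp_apply]
    congr 2
    simp
  | @op n m m' f t ih =>
    simp only [eval, Term.subst, ih, eval_cast, op_natural, ← Functor.map_comp_apply,
      eqToHom_tensor_assoc]
    congr 2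
    simp

end Interp

/-! ### Graded algebraic theories -/

/-- A presentation of a graded algebraic theory: a signature and, for each grade, a set of pairs
of terms of that grade (in finitely many variables). -/
structure Theory (M : Type u) [SmallCategory M] [MonoidalCategory M] : Type (u + 1) where
  sig : Signature M
  eqs (n : ℕ) (m : M) : Set (Term sig (Fin n) m × Term sig (Fin n) m)

namespace Theory

variable {M : Type u} [SmallCategory M] [MonoidalCategory M]

/-- Provable equality of terms. -/
inductive Entails [IsStrictMonoidal M] (T : Theory M) :
    {X : Type w} → {m : M} → Term T.sig X m → Term T.sig X m → Prop
  | refl {X : Type w} {m : M} (t : Term T.sig X m) : Entails T t t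
  | symm {X : Type w} {m : M} {s t : Term T.sig X m} : Entails T s t → Entails T t s
  | trans {X : Type w} {m : M} {s t r : Term T.sig X m} :
      Entails T s t → Entails T t r → Entails T s r
  | congr {X : Type w} {n : ℕ} {m m' : M} (f : T.sig n m) {s t : Fin n → Term T.sig X m'} :
      (∀ i, Entails T (s i) (t i)) → Entails T (.op f s) (.op f t)
  | subst {X Y : Type w} {m k : M} {s t : Term T.sig X m} (σ : X → Term T.sig Y k) :
      Entails T s t → Entails T (s.subst σ) (t.subst σ)
  | ax {X : Type w} {n : ℕ} {m : M} {s t : Term T.sig (Fin n) m} (h : (s, t) ∈ T.eqs n m)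
      (r : Fin n → X) : Entails T (s.rename r) (t.rename r)
  | coe_congr {X : Type w} {m m' : M} (e : m ⟶ m') {s t : Term T.sig X m} :
      Entails T s t → Entails T (.coe e s) (.coe e t)
  | coe_id {X : Type w} {m : M} (t : Term T.sig X m) : Entails T (.coe (𝟙 m) t) t
  | coe_comp {X : Type w} {m m' m'' : M} (e : m ⟶ m') (e' : m' ⟶ m'') (t : Term T.sig X m) :
      Entails T (.coe e' (.coe e t)) (.coe (e ≫ e') t)
  | op_coe {X : Type w} {n : ℕ} {m m' m'' : M} (f : T.sig n m) (t : Fin n → Term T.sig X m')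
      (e : m' ⟶ m'') : Entails T (.op f (fun i => .coe e (t i))) (.coe (m ◁ e) (.op f t))

/-- An interpretation of the signature of `T` is a model of `T` if it satisfies the equations. -/
def IsModel (T : Theory M) {A : M ⥤ Type v} (I : Interp T.sig A) : Prop :=
  ∀ ⦃n : ℕ⦄ ⦃m : M⦄ ⦃s t : Term T.sig (Fin n) m⦄, (s, t) ∈ T.eqs n m →
    ∀ ⦃k : M⦄ (a : Fin n → A.obj k), I.eval a s = I.eval a t

variable [IsStrictMonoidal M]

theorem IsModel.sound {T : Theory M} {A : M ⥤ Type v} {I : Interp T.sig A} (hI : T.IsModel I)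
    {X : Type w} {m : M} {s t : Term T.sig X m} (h : T.Entails s t) {k : M} (a : X → A.obj k) :
    I.eval a s = I.eval a t := by
  induction h generalizing k with
  | refl t => rfl
  | symm _ ih => exact (ih a).symm
  | trans _ _ ih ih' => exact (ih a).trans (ih' a)
  | congr f _ ih => simp only [Interp.eval, ih]
  | subst σ _ ih => simp only [Interp.eval_subst, ih]
  | ax h r => simpa only [Interp.eval_rename] using hI h _
  | coe_congr e _ ih => simp only [Interp.eval, ih]
  | coe_id t => simp [Interp.eval]
  | coe_comp e e' t => simp [Interp.eval]
  | op_coe f t e =>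
    simp only [Interp.eval, Interp.op_natural, ← Functor.map_comp_apply]
    congr 2
    simp

/-- Provable equality as an equivalence relation on terms of grade `m`. -/
def setoid (T : Theory M) (X : Type w) (m : M) : Setoid (Term T.sig X m) where
  r s t := T.Entails s t
  iseqv := ⟨.refl, .symm, .trans⟩

/-- The underlying presheaf of the free model on `X`: terms modulo provable equality. -/
def free (T : Theory M) (X : Type w) : M ⥤ Type (max u w) where
  obj m := Quotient (T.setoid X m)
  map e := TypeCat.ofHom (Quotient.map (Term.coe e) fun _ _ h => Entails.coe_congr e h)
  map_id m := by
    ext t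
    induction t using Quotient.inductionOn with
    | h t => exact Quotient.sound (s := T.setoid X m) (Entails.coe_id t)
  map_comp {m m' m''} e e' := by
    ext t
    induction t using Quotient.inductionOn with
    | h t => exact Quotient.sound (s := T.setoid X m'') (Entails.coe_comp e e' t).symm

/-- The class of a term in the free model. -/
def cls (T : Theory M) {X : Type w} {m : M} (t : Term T.sig X m) : (T.free X).obj m :=
  Quotient.mk (T.setoid X m) t

theorem cls_eq {T : Theory M} {X : Type w} {m : M} {s t : Term T.sig X m} (h : T.Entails s t) :
    T.cls s = T.cls t := Quotient.sound (s := T.setoid X m) h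

theorem map_cls {T : Theory M} {X : Type w} {m m' : M} (e : m ⟶ m') (t : Term T.sig X m) :
    (T.free X).map e (T.cls t) = T.cls (.coe e t) := rfl

/-- A choice of a representative. -/
noncomputable def out (T : Theory M) {X : Type w} {m : M} (c : (T.free X).obj m) :
    Term T.sig X m := Quotient.out (s := T.setoid X m) c

theorem cls_out (T : Theory M) {X : Type w} {m : M} (c : (T.free X).obj m) :
    T.cls (T.out c) = c := Quotient.out_eq (s := T.setoid X m) c

theorem entails_of_cls_eq {T : Theory M} {X : Type w} {m : M} {s t : Term T.sig X m}
    (h : T.cls s = T.cls t) : T.Entails s t := Quotient.exact (s := T.setoid X m) h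

theorem exists_cls (T : Theory M) {X : Type w} {m : M} (c : (T.free X).obj m) :
    ∃ t, T.cls t = c := ⟨_, T.cls_out c⟩

theorem cls_cast {T : Theory M} {X : Type w} {m m' : M} (h : m = m') (t : Term T.sig X m) :
    T.cls (t.cast h) = (T.free X).map (eqToHom h) (T.cls t) := by
  subst h
  simp [Term.cast]

/-- The interpretation of operations in the free model,
`f ([t₁], …, [tₙ]) = [f (t₁, …, tₙ)]`. -/
noncomputable def freeInterp (T : Theory M) (X : Type w) : Interp T.sig (T.free X) where
  op f _ a := T.cls (.op f fun i => T.out (a i))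
  op_natural f k k' e a := by
    refine cls_eq (.trans (.congr f fun _ => ?_) (Entails.op_coe f (fun i => T.out (a i)) e))
    apply entails_of_cls_eq
    rw [cls_out, ← map_cls, cls_out]

theorem freeInterp_op_cls (T : Theory M) {X : Type w} {n : ℕ} {m k : M} (f : T.sig n m)
    (t : Fin n → Term T.sig X k) : (T.freeInterp X).op f (fun i => T.cls (t i)) = T.cls (.op f t) :=
  cls_eq (.congr f fun _ => entails_of_cls_eq (T.cls_out _))

theorem freeInterp_eval_cls (T : Theory M) {X : Type w} {Y : Type v} {m k : M}
    (σ : Y → Term T.sig X k) (t : Term T.sig Y m) :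
    (T.freeInterp X).eval (fun y => T.cls (σ y)) t = T.cls (t.subst σ) := by
  induction t with
  | var y =>
    simp only [Interp.eval, Term.subst, cls_cast, eqToHom_unit_tensor]
  | coe e t ih => simp only [Interp.eval, Term.subst, ih, map_cls]
  | @op n m m' f t ih =>
    simp only [Interp.eval, Term.subst, ih, cls_cast, eqToHom_tensor_assoc, freeInterp_op_cls]

/-- The free model on `X` is a model. -/
theorem freeInterp_isModel (T : Theory M) (X : Type w) : T.IsModel (T.freeInterp X) := by
  intro n m s t h k a
  obtain ⟨σ, rfl⟩ : ∃ σ : Fin n → Term T.sig X k, a = fun i => T.cls (σ i) :=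
    ⟨fun i => T.out (a i), funext fun i => (T.cls_out (a i)).symm⟩
  rw [freeInterp_eval_cls, freeInterp_eval_cls]
  have hr : ∀ {m : M} (s : Term T.sig (Fin n) m),
      (s.rename ULift.up.{w}).subst (fun i => σ i.down) = s.subst σ := by
    intro m s
    induction s with
    | var x => rfl
    | coe e t ih => simp only [Term.rename, Term.subst, ih]
    | op f t ih => simp only [Term.rename, Term.subst, ih]
  rw [← hr s, ← hr t]
  exact cls_eq (.subst _ (.ax h _))

/-- The interpretation, in a model, of terms modulo provable equality. -/
def evalCls {T : Theory M} {A : M ⥤ Type v} {I : Interp T.sig A} (hI : T.IsModel I)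
    {X : Type w} {k : M} (a : X → A.obj k) {m : M} (c : (T.free X).obj m) : A.obj (m ⊗ k) :=
  Quotient.lift (s := T.setoid X m) (I.eval a) (fun _ _ h => hI.sound h a) c

theorem evalCls_cls {T : Theory M} {A : M ⥤ Type v} {I : Interp T.sig A} (hI : T.IsModel I)
    {X : Type w} {k : M} (a : X → A.obj k) {m : M} (t : Term T.sig X m) :
    evalCls hI a (T.cls t) = I.eval a t := rfl

theorem evalCls_congr {T : Theory M} {A : M ⥤ Type v} {I I' : Interp T.sig A}
    (hI : T.IsModel I) (hI' : T.IsModel I') (h : I = I') {X : Type w} {k : M} (a : X → A.obj k)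
    {m : M} (c : (T.free X).obj m) : evalCls hI a c = evalCls hI' a c := by
  subst h
  rfl

theorem evalCls_map {T : Theory M} {A : M ⥤ Type v} {I : Interp T.sig A} (hI : T.IsModel I)
    {X : Type w} {k : M} (a : X → A.obj k) {m m' : M} (e : m ⟶ m') (c : (T.free X).obj m) :
    evalCls hI a ((T.free X).map e c) = A.map (e ▷ k) (evalCls hI a c) := by
  obtain ⟨t, rfl⟩ := T.exists_cls c
  rfl

theorem evalCls_natural {T : Theory M} {A : M ⥤ Type v} {I : Interp T.sig A} (hI : T.IsModel I)
    {X : Type w} {k k' : M} (e : k ⟶ k') (a : X → A.obj k) {m : M} (c : (T.free X).obj m) :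
    evalCls hI (fun x => A.map e (a x)) c = A.map (m ◁ e) (evalCls hI a c) := by
  obtain ⟨t, rfl⟩ := T.exists_cls c
  exact I.eval_natural e a t

theorem evalCls_evalCls {T : Theory M} {A : M ⥤ Type v} {I : Interp T.sig A} (hI : T.IsModel I)
    {X : Type w} {Y : Type*} {j k : M} (b : X → A.obj k) (a : Y → (T.free X).obj j) {m : M}
    (c : (T.free Y).obj m) :
    evalCls hI b (evalCls (T.freeInterp_isModel X) a c) =
      A.map (α_ m j k).inv (evalCls hI (fun y => evalCls hI b (a y)) c) := by
  obtain ⟨t, rfl⟩ := T.exists_cls c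
  obtain ⟨σ, rfl⟩ : ∃ σ : Y → Term T.sig X j, a = fun i => T.cls (σ i) :=
    ⟨fun i => T.out (a i), funext fun i => (T.cls_out (a i)).symm⟩
  simp only [evalCls_cls, freeInterp_eval_cls, Interp.eval_subst]

/-- A translation of the operations of `S` into terms of `T` turns every model of `T` into an
interpretation of `S`. -/
def pullback {S : Signature M} {T : Theory M} {A : M ⥤ Type v} {I : Interp T.sig A}
    (hI : T.IsModel I) (φ : ∀ ⦃n : ℕ⦄ ⦃m : M⦄, S n m → (T.free (Fin n)).obj m) : Interp S A where
  op f _ a := evalCls hI a (φ f)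
  op_natural f _ _ e a := evalCls_natural hI e a (φ f)

theorem evalCls_pullback_eval {S : Signature M} {T : Theory M} {A : M ⥤ Type v}
    {I : Interp T.sig A} (hI : T.IsModel I)
    (φ : ∀ ⦃n : ℕ⦄ ⦃m : M⦄, S n m → (T.free (Fin n)).obj m)
    {X : Type w} {Y : Type*} {j k : M} (b : X → A.obj k) (a : Y → (T.free X).obj j) {m : M}
    (s : Term S Y m) :
    evalCls hI b ((pullback (T.freeInterp_isModel X) φ).eval a s) =
      A.map (α_ m j k).inv ((pullback hI φ).eval (fun y => evalCls hI b (a y)) s) := by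
  induction s with
  | var y =>
    simp only [Interp.eval, evalCls_map, ← Functor.map_comp_apply]
    congr 2
    simp
  | coe e t ih =>
    simp only [Interp.eval, evalCls_map, ih, ← Functor.map_comp_apply]
    congr 2
    simp
  | @op n m m' f t ih =>
    simp only [Interp.eval, evalCls_map, pullback]
    erw [evalCls_evalCls]
    simp only [pullback] at ih
    simp only [ih, evalCls_natural, ← Functor.map_comp_apply]
    congr 2
    simp

/-- The generic element of the free model on `X`: the variables. -/
def vars (T : Theory M) (X : Type w) (x : X) : (T.free X).obj (𝟙_ M) := T.cls (.var x)

theorem evalCls_vars {T : Theory M} {A : M ⥤ Type v} {I : Interp T.sig A} (hI : T.IsModel I)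
    {X : Type w} {k : M} (a : X → A.obj k) (x : X) :
    evalCls hI a (T.vars X x) = A.map (λ_ k).inv (a x) := rfl

theorem evalCls_free_vars (T : Theory M) {X : Type w} {m : M} (c : (T.free X).obj m) :
    (T.free X).map (ρ_ m).hom (evalCls (T.freeInterp_isModel X) (T.vars X) c) = c := by
  obtain ⟨t, rfl⟩ := T.exists_cls c
  rw [evalCls_cls]
  induction t with
  | var x =>
    simp only [Interp.eval, vars, ← Functor.map_comp_apply]
    simp [unitors_inv_equal]
  | coe e t ih =>
    simp only [Interp.eval, ← Functor.map_comp_apply]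
    rw [rightUnitor_naturality, Functor.map_comp_apply, ih, map_cls]
  | @op n m m' f t ih =>
    simp only [Interp.eval, ← Functor.map_comp_apply]
    rw [show (α_ m m' (𝟙_ M)).inv ≫ (ρ_ (m ⊗ m')).hom = m ◁ (ρ_ m').hom by simp,
      ← Interp.op_natural]
    simp only [ih, freeInterp_op_cls]

/-! ### The category of graded algebraic theories -/

/-- A morphism of theories `T ⟶ T'` sends each operation of `T` of arity `n` and grade `m` to a
term of `T'` of grade `m` in `n` variables, modulo provable equality, in such a way that the
free models of `T'` become models of `T`. -/
@[ext]
structure Hom (T T' : Theory M) : Type u where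
  app : ∀ ⦃n : ℕ⦄ ⦃m : M⦄, T.sig n m → (T'.free (Fin n)).obj m
  isModel (k : ℕ) : T.IsModel (pullback (T'.freeInterp_isModel (Fin k)) app)

namespace Hom

/-- The extension of a morphism of theories to terms modulo provable equality: a class `[t]` is
sent to the interpretation of `t` in the free model, at the generic element. -/
noncomputable def onFree {T T' : Theory M} (φ : Hom T T') {n : ℕ} {m : M} (c : (T.free (Fin n)).obj m) :
    (T'.free (Fin n)).obj m :=
  (T'.free (Fin n)).map (ρ_ m).hom (evalCls (φ.isModel n) (T'.vars (Fin n)) c)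

theorem evalCls_onFree_cls {T T' : Theory M} (φ : Hom T T') {A : M ⥤ Type v}
    {I : Interp T'.sig A} (hI : T'.IsModel I) {n : ℕ} {m k : M} (a : Fin n → A.obj k)
    (s : Term T.sig (Fin n) m) :
    evalCls hI a (φ.onFree (T.cls s)) = (pullback hI φ.app).eval a s := by
  rw [onFree, evalCls_map, evalCls_cls, evalCls_pullback_eval]
  simp only [evalCls_vars, Interp.eval_natural, ← Functor.map_comp_apply]
  simp

/-- Models can be pulled back along morphisms of theories. -/
theorem pullback_isModel {T T' : Theory M} (φ : Hom T T') {A : M ⥤ Type v}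
    {I : Interp T'.sig A} (hI : T'.IsModel I) : T.IsModel (pullback hI φ.app) := by
  intro n m s t h k a
  rw [← evalCls_onFree_cls, ← evalCls_onFree_cls]
  congr 2
  have := cls_eq (Entails.ax (T := T) h id)
  have hid : ∀ {m : M} (s : Term T.sig (Fin n) m), s.rename id = s := by
    intro m s
    induction s with
    | var x => rfl
    | coe e t ih => simp only [Term.rename, ih]
    | op f t ih => simp only [Term.rename, ih]
  rwa [hid, hid] at this

theorem evalCls_onFree {T T' : Theory M} (φ : Hom T T') {A : M ⥤ Type v}
    {I : Interp T'.sig A} (hI : T'.IsModel I) {n : ℕ} {m k : M} (a : Fin n → A.obj k)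
    (c : (T.free (Fin n)).obj m) :
    evalCls hI a (φ.onFree c) = evalCls (φ.pullback_isModel hI) a c := by
  obtain ⟨t, rfl⟩ := T.exists_cls c
  exact evalCls_onFree_cls φ hI a t

/-- The generic term `f (x₁, …, xₙ)`. Its grade `m ⊗ I` is equal to `m`. -/
def generic (T : Theory M) {n : ℕ} {m : M} (f : T.sig n m) : Term T.sig (Fin n) m :=
  (Term.op f Term.var).cast (IsStrictMonoidal.tensor_unit m)

theorem evalCls_generic {T : Theory M} {A : M ⥤ Type v} {I : Interp T.sig A}
    (hI : T.IsModel I) {n : ℕ} {m k : M} (f : T.sig n m) (a : Fin n → A.obj k) :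
    evalCls hI a (T.cls (generic T f)) = I.op f a := by
  rw [evalCls_cls, generic, Interp.eval_cast, ← IsStrictMonoidal.rightUnitor_eq]
  simp only [Interp.eval, Interp.op_natural, ← Functor.map_comp_apply]
  simp

/-- The identity morphism sends `f` to `[f (x₁, …, xₙ)]`. -/
def id (T : Theory M) : Hom T T where
  app _ _ f := T.cls (generic T f)
  isModel k := by
    have h : pullback (T.freeInterp_isModel (Fin k)) (fun _ _ f => T.cls (generic T f)) =
        T.freeInterp (Fin k) := by
      ext n m f j a
      exact evalCls_generic (T.freeInterp_isModel _) f a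
    rw [h]
    exact T.freeInterp_isModel _

/-- The composite of `φ` and `ψ` sends `f` to the extension of `ψ` applied to `φ f`. -/
noncomputable def comp {T T' T'' : Theory M} (φ : Hom T T') (ψ : Hom T' T'') : Hom T T'' where
  app _ _ f := ψ.onFree (φ.app f)
  isModel k := by
    have h : pullback (T''.freeInterp_isModel (Fin k)) (fun _ _ f => ψ.onFree (φ.app f)) =
        pullback (ψ.isModel k) φ.app := by
      ext n m f j a
      exact evalCls_onFree ψ _ a _
    rw [h]
    exact φ.pullback_isModel _

end Hom

end Theory

/-- The category `GS` of graded algebraic theories. -/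
abbrev GS (M : Type u) [SmallCategory M] [MonoidalCategory M] : Type (u + 1) := Theory M

noncomputable instance {M : Type u} [SmallCategory M] [MonoidalCategory M]
    [IsStrictMonoidal M] : Category.{u} (GS M) where
  Hom := Theory.Hom
  id := Theory.Hom.id
  comp := Theory.Hom.comp
  id_comp {T T'} φ := by
    refine Theory.Hom.ext (funext fun n => funext fun m => funext fun f => ?_)
    change (T'.free (Fin n)).map (ρ_ m).hom (Theory.evalCls (φ.isModel n) (T'.vars (Fin n))
      (T.cls (Theory.Hom.generic T f))) = φ.app f
    rw [Theory.Hom.evalCls_generic]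
    exact T'.evalCls_free_vars _
  comp_id {T T'} φ := by
    refine Theory.Hom.ext (funext fun n => funext fun m => funext fun f => ?_)
    refine Eq.trans ?_ (T'.evalCls_free_vars (φ.app f))
    refine congrArg _ (Theory.evalCls_congr _ _ ?_ _ _)
    ext n m f j a
    exact Theory.Hom.evalCls_generic (T'.freeInterp_isModel _) f a
  assoc {T₁ T₂ T₃ T₄} φ ψ χ := by
    refine Theory.Hom.ext (funext fun n => funext fun m => funext fun f => ?_)
    refine congrArg _ (Eq.trans (ψ.evalCls_onFree (χ.isModel n) _ (φ.app f)) ?_).symm |>.symm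
    refine Theory.evalCls_congr _ _ ?_ _ _
    ext n m f j a
    exact (χ.evalCls_onFree (T₄.freeInterp_isModel _) a (ψ.app f)).symm

/-! ### Categories enriched in presheaves

A category enriched in functors `M ⥤ Type u` with the Day convolution, in elementary terms:
morphisms have grades in `M`, which multiply under composition. -/

/-- An `[M, Set]`-category with objects `C`. Since `M` is strict, the structural isomorphisms in
the axioms are identities. -/
structure GradedCat (M : Type u) [SmallCategory M] [MonoidalCategory M] (C : Type w) where
  hom : C → C → (M ⥤ Type u)
  id (X : C) : (hom X X).obj (𝟙_ M)
  comp {X Y Z : C} {m₁ m₂ : M} (g : (hom Y Z).obj m₁) (f : (hom X Y).obj m₂) :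
    (hom X Z).obj (m₁ ⊗ m₂)
  comp_natural {X Y Z : C} {m₁ m₁' m₂ m₂' : M} (e₁ : m₁ ⟶ m₁') (e₂ : m₂ ⟶ m₂')
    (g : (hom Y Z).obj m₁) (f : (hom X Y).obj m₂) :
    comp ((hom Y Z).map e₁ g) ((hom X Y).map e₂ f) = (hom X Z).map (e₁ ⊗ₘ e₂) (comp g f)
  id_comp {X Y : C} {m : M} (f : (hom X Y).obj m) :
    (hom X Y).map (λ_ m).hom (comp (id Y) f) = f
  comp_id {X Y : C} {m : M} (f : (hom X Y).obj m) :
    (hom X Y).map (ρ_ m).hom (comp f (id X)) = f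
  assoc {W X Y Z : C} {m₁ m₂ m₃ : M} (h : (hom Y Z).obj m₃) (g : (hom X Y).obj m₂)
    (f : (hom W X).obj m₁) :
    (hom W Z).map (α_ m₃ m₂ m₁).hom (comp (comp h g) f) = comp h (comp g f)

namespace GradedCat

variable {M : Type u} [SmallCategory M] [MonoidalCategory M]

/-- The full subcategory on a family of objects. -/
def induced {C : Type v} {D : Type w} (A : GradedCat M D) (i : C → D) : GradedCat M C where
  hom X Y := A.hom (i X) (i Y)
  id X := A.id (i X)
  comp g f := A.comp g f
  comp_natural := A.comp_natural
  id_comp := A.id_comp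
  comp_id := A.comp_id
  assoc := A.assoc

/-- The presheaf `[G, H]` with `[G, H] m = Nat(G, H(- ⊗ m))`: the closed structure of the
category of presheaves with the twisted Day convolution. -/
def presheafHom (G H : M ⥤ Type u) : M ⥤ Type u where
  obj m := G ⟶ tensorRight m ⋙ H
  map e := TypeCat.ofHom fun τ => τ ≫ Functor.whiskerRight ((tensoringRight M).map e) H
  map_id m := by
    ext τ : 3
    simp
  map_comp e e' := by
    ext τ : 3
    simp

/-- The opposite of the self-enriched category of presheaves: morphisms `X → Y` of grade `m` are
the natural transformations `Y ⟶ X(- ⊗ m)`. -/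
def presheafOp (M : Type u) [SmallCategory M] [MonoidalCategory M] :
    GradedCat M (M ⥤ Type u) where
  hom X Y := presheafHom Y X
  id X :=
    { app := fun k => X.map (ρ_ k).inv
      naturality := fun k k' e => by
        change X.map e ≫ X.map (ρ_ k').inv = X.map (ρ_ k).inv ≫ X.map (e ▷ 𝟙_ M)
        rw [← Functor.map_comp, ← Functor.map_comp, rightUnitor_inv_naturality] }
  comp {X Y Z m₁ m₂} g f :=
    { app := fun k => g.app k ≫ f.app (k ⊗ m₁) ≫ X.map (α_ k m₁ m₂).hom
      naturality := fun k k' e => by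
        have h₁ : Z.map e ≫ g.app k' = g.app k ≫ Y.map (e ▷ m₁) := g.naturality e
        have h₂ : Y.map (e ▷ m₁) ≫ f.app (k' ⊗ m₁) =
          f.app (k ⊗ m₁) ≫ X.map ((e ▷ m₁) ▷ m₂) := f.naturality _
        change Z.map e ≫ g.app k' ≫ f.app (k' ⊗ m₁) ≫ X.map (α_ k' m₁ m₂).hom =
          (g.app k ≫ f.app (k ⊗ m₁) ≫ X.map (α_ k m₁ m₂).hom) ≫ X.map (e ▷ (m₁ ⊗ m₂))
        rw [reassoc_of% h₁, reassoc_of% h₂, Category.assoc, Category.assoc, ← Functor.map_comp,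
          ← Functor.map_comp, associator_naturality_left] }
  comp_natural {X Y Z m₁ m₁' m₂ m₂'} e₁ e₂ g f := by
    refine NatTrans.ext (funext fun k => ?_)
    have h : Y.map (k ◁ e₁) ≫ f.app (k ⊗ m₁') = f.app (k ⊗ m₁) ≫ X.map ((k ◁ e₁) ▷ m₂) :=
      f.naturality _
    change (g.app k ≫ Y.map (k ◁ e₁)) ≫ (f.app (k ⊗ m₁') ≫ X.map ((k ⊗ m₁') ◁ e₂)) ≫
        X.map (α_ k m₁' m₂').hom =
      (g.app k ≫ f.app (k ⊗ m₁) ≫ X.map (α_ k m₁ m₂).hom) ≫ X.map (k ◁ (e₁ ⊗ₘ e₂))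
    simp only [Category.assoc, reassoc_of% h, ← Functor.map_comp]
    simp [MonoidalCategory.tensorHom_def]
  id_comp {X Y m} f := by
    refine NatTrans.ext (funext fun k => ?_)
    have h : Y.map (ρ_ k).inv ≫ f.app (k ⊗ 𝟙_ M) = f.app k ≫ X.map ((ρ_ k).inv ▷ m) :=
      f.naturality _
    change (Y.map (ρ_ k).inv ≫ f.app (k ⊗ 𝟙_ M) ≫ X.map (α_ k (𝟙_ M) m).hom) ≫
      X.map (k ◁ (λ_ m).hom) = f.app k
    rw [reassoc_of% h, Category.assoc, ← Functor.map_comp, ← Functor.map_comp]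
    simp
  comp_id {X Y m} f := by
    refine NatTrans.ext (funext fun k => ?_)
    change (f.app k ≫ X.map (ρ_ (k ⊗ m)).inv ≫ X.map (α_ k m (𝟙_ M)).hom) ≫
      X.map (k ◁ (ρ_ m).hom) = f.app k
    rw [Category.assoc, Category.assoc, ← Functor.map_comp, ← Functor.map_comp]
    simp
  assoc {W X Y Z m₁ m₂ m₃} h g f := by
    refine NatTrans.ext (funext fun k => ?_)
    have hf : X.map (α_ k m₃ m₂).hom ≫ f.app (k ⊗ (m₃ ⊗ m₂)) =
        f.app ((k ⊗ m₃) ⊗ m₂) ≫ W.map ((α_ k m₃ m₂).hom ▷ m₁) := f.naturality _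
    change ((h.app k ≫ g.app (k ⊗ m₃) ≫ X.map (α_ k m₃ m₂).hom) ≫ f.app (k ⊗ (m₃ ⊗ m₂)) ≫
        W.map (α_ k (m₃ ⊗ m₂) m₁).hom) ≫ W.map (k ◁ (α_ m₃ m₂ m₁).hom) =
      h.app k ≫ (g.app (k ⊗ m₃) ≫ f.app ((k ⊗ m₃) ⊗ m₂) ≫ W.map (α_ (k ⊗ m₃) m₂ m₁).hom) ≫
        W.map (α_ k m₃ (m₂ ⊗ m₁)).hom
    simp only [Category.assoc, reassoc_of% hf, ← Functor.map_comp]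
    simp

/-- An `[M, Set]`-functor. -/
structure Fun {C : Type v} {D : Type w} (A : GradedCat M C) (B : GradedCat M D) where
  obj : C → D
  map (X Y : C) : A.hom X Y ⟶ B.hom (obj X) (obj Y)
  map_id (X : C) : (map X X).app (𝟙_ M) (A.id X) = B.id (obj X)
  map_comp {X Y Z : C} {m₁ m₂ : M} (g : (A.hom Y Z).obj m₁) (f : (A.hom X Y).obj m₂) :
    (map X Z).app (m₁ ⊗ m₂) (A.comp g f) = B.comp ((map Y Z).app m₁ g) ((map X Y).app m₂ f)

namespace Fun

variable {C : Type v} {D : Type w} {A : GradedCat M C} {B : GradedCat M D}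

/-- The identity functor. -/
def id (A : GradedCat M C) : Fun A A where
  obj X := X
  map X Y := 𝟙 (A.hom X Y)
  map_id _ := rfl
  map_comp _ _ := rfl

/-- Composition of functors, in diagrammatic order. -/
def comp {D' : Type*} {B' : GradedCat M D'} (F : Fun A B) (G : Fun B B') : Fun A B' where
  obj X := G.obj (F.obj X)
  map X Y := F.map X Y ≫ G.map (F.obj X) (F.obj Y)
  map_id X := by
    change (G.map _ _).app _ ((F.map X X).app _ _) = _
    rw [F.map_id, G.map_id]
  map_comp {X Y Z m₁ m₂} g f := by
    change (G.map _ _).app _ ((F.map X Z).app _ _) = _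
    rw [F.map_comp, G.map_comp]
    rfl

end Fun

/-- An identity-on-objects `[M, Set]`-functor. -/
structure IdFun {C : Type w} (A B : GradedCat M C) where
  map (X Y : C) : A.hom X Y ⟶ B.hom X Y
  map_id (X : C) : (map X X).app (𝟙_ M) (A.id X) = B.id X
  map_comp {X Y Z : C} {m₁ m₂ : M} (g : (A.hom Y Z).obj m₁) (f : (A.hom X Y).obj m₂) :
    (map X Z).app (m₁ ⊗ m₂) (A.comp g f) = B.comp ((map Y Z).app m₁ g) ((map X Y).app m₂ f)

/-- An identity-on-objects functor, as a functor. -/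
def IdFun.toFun {C : Type w} {A B : GradedCat M C} (F : IdFun A B) : Fun A B where
  obj X := X
  map := F.map
  map_id := F.map_id
  map_comp := F.map_comp

/-! ### Cotensors -/

/-- For `ν : G ⟶ A(P, X)`, the component `A(B, P) m → Nat(G, A(B, X)(- ⊗ m))` of the induced map
`A(B, P) ⟶ [G, A(B, X)]`, which sends `f` to `x ↦ ν x ∘ f`. -/
def cotensorMap {C : Type w} (A : GradedCat M C) {G : M ⥤ Type u} {X P : C}
    (ν : G ⟶ A.hom P X) (B : C) (m : M) (f : (A.hom B P).obj m) :
    (presheafHom G (A.hom B X)).obj m where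
  app k := TypeCat.ofHom fun x => A.comp (ν.app k x) f
  naturality k k' e := by
    ext x
    change A.comp (ν.app k' (G.map e x)) f = (A.hom B X).map (e ▷ m) (A.comp (ν.app k x) f)
    have h := A.comp_natural e (𝟙 m) (ν.app k x) f
    rw [tensorHom_id, Functor.map_id_apply] at h
    rw [← h, NatTrans.naturality_apply]

/-- `ν : G ⟶ A(P, X)` exhibits `P` as the cotensor of `X` by the presheaf `G`. -/
def IsCotensor {C : Type w} (A : GradedCat M C) {G : M ⥤ Type u} {X P : C}
    (ν : G ⟶ A.hom P X) : Prop :=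
  ∀ (B : C) (m : M), Function.Bijective (A.cotensorMap ν B m)

/-- The presheaf `n · y(I)`, the `n`-fold coproduct of the representable presheaf `M(I, -)`. -/
def arity (M : Type u) [SmallCategory M] [MonoidalCategory M] (n : ℕ) : M ⥤ Type u where
  obj m := Fin n × (𝟙_ M ⟶ m)
  map e := TypeCat.ofHom fun x => (x.1, x.2 ≫ e)

/-- The `[M, Set]`-category `N_M`: the opposite of the full subcategory of presheaves on the
objects `n · y(I)`, which are identified with the natural numbers `n`. -/
def arities (M : Type u) [SmallCategory M] [MonoidalCategory M] : GradedCat M ℕ :=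
  (presheafOp M).induced (arity M)

/-- Existence of all cotensors by objects of `N_M`. -/
def HasArityCotensors {C : Type w} (A : GradedCat M C) : Prop :=
  ∀ (n : ℕ) (X : C), ∃ (P : C) (ν : arity M n ⟶ A.hom P X), A.IsCotensor ν

/-- Preservation of all cotensors by objects of `N_M`. -/
def Fun.PreservesArityCotensors {C : Type v} {D : Type w} {A : GradedCat M C}
    {B : GradedCat M D} (F : Fun A B) : Prop :=
  ∀ (n : ℕ) (X P : C) (ν : arity M n ⟶ A.hom P X),
    A.IsCotensor ν → B.IsCotensor (ν ≫ F.map P X)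

end GradedCat

/-! ### Graded Lawvere theories -/

/-- A graded Lawvere theory: an `[M, Set]`-category with `N_M`-cotensors and an
identity-on-objects `N_M`-cotensor preserving functor from `N_M`. -/
structure GLaw (M : Type u) [SmallCategory M] [MonoidalCategory M] : Type (u + 1) where
  cat : GradedCat M ℕ
  hasCotensors : cat.HasArityCotensors
  J : GradedCat.IdFun (GradedCat.arities M) cat
  preserves : J.toFun.PreservesArityCotensors

namespace GLaw

variable {M : Type u} [SmallCategory M] [MonoidalCategory M]

/-- A morphism of graded Lawvere theories is a functor that commutes with the functors
from `N_M`. -/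
@[ext]
structure Hom (L L' : GLaw M) : Type u where
  functor : GradedCat.Fun L.cat L'.cat
  comm : L.J.toFun.comp functor = L'.J.toFun

/-- The category `GLaw` of graded Lawvere theories. -/
instance : Category.{u} (GLaw M) where
  Hom := Hom
  id L := { functor := GradedCat.Fun.id L.cat, comm := rfl }
  comp {L L' L''} F G :=
    { functor := F.functor.comp G.functor
      comm := by
        rw [← G.comm, ← F.comm]
        rfl }
  id_comp _ := rfl
  comp_id _ := rfl
  assoc _ _ _ := rfl

end GLaw

end Graded

namespace Graded

namespace GradedCat

variable {M : Type u} [SmallCategory M] [MonoidalCategory M]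

/-! ### Composition and the action of morphisms of grades. -/

section Composition

variable {C : Type w} (A : GradedCat M C) {X Y Z : C} {m₁ m₁' m₂ m₂' : M}

/-! A theory `T` is sent to the graded category whose morphisms `k → n` of grade `m` are the
`n`-tuples of elements of grade `m` of the free model on `k` variables, composed by substitution.
This functor is shown to be full, faithful and essentially surjective.

The enriched cotensors are first made elementary. By Yoneda, `arity M n` is free on `n` generators
of grade `I`, so a cotensor by it is an `n`-th power: an object `P` with projections `p i : P → X`
of grade `I`, such that morphisms `B → P` of grade `m` correspond to `n`-tuples of morphisms `B → X`
of grade `m` (`isCotensor_iff_isPower`). In a graded Lawvere theory the object `n` is therefore the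
`n`-th power of `1` along the images of the projections of arities (`proj_isPower`), and everything
is governed by the presheaves of operations `n → 1`.

Faithfulness: `φ f` is the value of the extension of `φ` at the generic term `f (x₁, …, xₙ)`.
Fullness: a functor compatible with the `J`s fixes the variables, so it acts componentwise on tuples
(`map_app_eq_freeMap`); as it also preserves composition, that is, substitution, it is determined by
its values at generic terms (`pullback_eval_freeMap`).

Essential surjectivity: for a Lawvere theory `L`, take all morphisms `n → 1` as operations, and as
axioms all pairs of terms with the same denotation in `L`. Every operation is denoted by its generic
term, and terms with equal denotations are equal by an axiom. Hence terms modulo provable equality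
are exactly the operations of `L` (`denote_bijective`), and powers extend this bijection to all
hom-presheaves. -/

theorem comp_map_left (e : m₁ ⟶ m₁') (g : (A.hom Y Z).obj m₁) (f : (A.hom X Y).obj m₂) :
    A.comp ((A.hom Y Z).map e g) f = (A.hom X Z).map (e ▷ m₂) (A.comp g f) := by
  simpa using A.comp_natural e (𝟙 m₂) g f

theorem comp_map_right (e : m₂ ⟶ m₂') (g : (A.hom Y Z).obj m₁) (f : (A.hom X Y).obj m₂) :
    A.comp g ((A.hom X Y).map e f) = (A.hom X Z).map (m₁ ◁ e) (A.comp g f) := by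
  simpa using A.comp_natural (𝟙 m₁) e g f

theorem id_comp' (f : (A.hom X Y).obj m₁) :
    A.comp (A.id Y) f = (A.hom X Y).map (λ_ m₁).inv f := by
  conv_rhs => rw [← A.id_comp f]
  simp only [← Functor.map_comp_apply]
  simp

theorem comp_id' (f : (A.hom X Y).obj m₁) :
    A.comp f (A.id X) = (A.hom X Y).map (ρ_ m₁).inv f := by
  conv_rhs => rw [← A.comp_id f]
  simp only [← Functor.map_comp_apply]
  simp

end Composition

/-! ### Natural transformations out of arities -/

/-- The generators of the presheaf `n · y(I)`. -/
def arityGen (M : Type u) [SmallCategory M] [MonoidalCategory M] {n : ℕ} (i : Fin n) :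
    (arity M n).obj (𝟙_ M) := (i, 𝟙 _)

theorem arity_eq_map_gen {n : ℕ} {k : M} (x : (arity M n).obj k) :
    x = (arity M n).map x.2 (arityGen M x.1) := by
  change x = (x.1, 𝟙 _ ≫ x.2)
  rw [Category.id_comp]
  rfl

theorem arity_app {n : ℕ} {H : M ⥤ Type u} (τ : arity M n ⟶ H) {k : M}
    (x : (arity M n).obj k) : τ.app k x = H.map x.2 (τ.app (𝟙_ M) (arityGen M x.1)) := by
  conv_lhs => rw [arity_eq_map_gen x]
  rw [NatTrans.naturality_apply]

theorem arity_hom_ext {n : ℕ} {H : M ⥤ Type u} {τ τ' : arity M n ⟶ H}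
    (h : ∀ i, τ.app (𝟙_ M) (arityGen M i) = τ'.app (𝟙_ M) (arityGen M i)) : τ = τ' := by
  ext k x
  exact (arity_app τ x).trans ((congrArg _ (h _)).trans (arity_app τ' x).symm)

/-- The natural transformation from `n · y(I)` with prescribed values at the generators. -/
def ofPoints {n : ℕ} {H : M ⥤ Type u} (a : Fin n → H.obj (𝟙_ M)) : arity M n ⟶ H where
  app k := TypeCat.ofHom fun x => H.map x.2 (a x.1)
  naturality k k' e := by
    ext x
    change H.map (x.2 ≫ e) (a x.1) = H.map e (H.map x.2 (a x.1))
    rw [Functor.map_comp_apply]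

theorem ofPoints_app_gen {n : ℕ} {H : M ⥤ Type u} (a : Fin n → H.obj (𝟙_ M)) (i : Fin n) :
    (ofPoints a).app (𝟙_ M) (arityGen M i) = a i := by
  change H.map (𝟙 _) (a i) = a i
  rw [Functor.map_id_apply]

theorem points_bijective (n : ℕ) (H : M ⥤ Type u) :
    Function.Bijective fun (τ : arity M n ⟶ H) (i : Fin n) => τ.app (𝟙_ M) (arityGen M i) :=
  ⟨fun _ _ h => arity_hom_ext (congrFun h), fun a => ⟨ofPoints a, funext (ofPoints_app_gen a)⟩⟩

omit [MonoidalCategory M] in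
theorem map_iso_bijective (H : M ⥤ Type u) {m m' : M} (e : m ≅ m') :
    Function.Bijective fun x => H.map e.hom x :=
  Function.bijective_iff_has_inverse.mpr ⟨fun x => H.map e.inv x,
    fun x => by simp [← Functor.map_comp_apply], fun x => by simp [← Functor.map_comp_apply]⟩

/-! ### Cotensors by arities as powers -/

section Power

variable {C : Type w} {A : GradedCat M C} {n : ℕ} {P X : C}

/-- The morphisms `p i : P → X` exhibit `P` as the `n`-th power of `X`. -/
def IsPower (A : GradedCat M C) {n : ℕ} {P X : C} (p : Fin n → (A.hom P X).obj (𝟙_ M)) : Prop :=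
  ∀ (B : C) (m : M), Function.Bijective fun (f : (A.hom B P).obj m) (i : Fin n) =>
    (A.hom B X).map (λ_ m).hom (A.comp (p i) f)

/-- Evaluation at the generators followed by the left unitor is a bijection from `Nat(n · y(I), A(B,
X)(- ⊗ m))` to `n`-tuples in `A(B, X) m`. Composed with `cotensorMap`, it is the map that defines a
power. -/
theorem isCotensor_iff_isPower (ν : arity M n ⟶ A.hom P X) :
    A.IsCotensor ν ↔ A.IsPower fun i => ν.app (𝟙_ M) (arityGen M i) := by
  refine forall_congr' fun B => forall_congr' fun m => ?_
  have h₁ : Function.Bijective fun (τ : (presheafHom (arity M n) (A.hom B X)).obj m)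
      (i : Fin n) => (A.hom B X).map (λ_ m).hom (τ.app (𝟙_ M) (arityGen M i)) :=
    (Function.Bijective.piMap fun _ : Fin n => map_iso_bijective (A.hom B X) (λ_ m)).comp
      (points_bijective n (tensorRight m ⋙ A.hom B X))
  exact (Function.Bijective.of_comp_iff' h₁ (A.cotensorMap ν B m)).symm

theorem IsPower.isCotensor {p : Fin n → (A.hom P X).obj (𝟙_ M)} (hp : A.IsPower p) :
    A.IsCotensor (ofPoints p) := by
  rw [isCotensor_iff_isPower]
  simpa only [ofPoints_app_gen] using hp

namespace IsPower

variable {p : Fin n → (A.hom P X).obj (𝟙_ M)} (hp : A.IsPower p) {B : C} {m : M}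

include hp in
theorem ext {f g : (A.hom B P).obj m} (h : ∀ i, A.comp (p i) f = A.comp (p i) g) : f = g :=
  (hp B m).1 (funext fun i => congrArg _ (h i))

/-- The morphism into a power with given components. -/
noncomputable def lift (a : Fin n → (A.hom B X).obj m) : (A.hom B P).obj m :=
  ((hp B m).2 a).choose

theorem comp_lift (a : Fin n → (A.hom B X).obj m) (i : Fin n) :
    A.comp (p i) (hp.lift a) = (A.hom B X).map (λ_ m).inv (a i) := by
  have h := congrFun ((hp B m).2 a).choose_spec i
  rw [← h]
  simp only [← Functor.map_comp_apply]
  simp [lift]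

theorem map_comp_lift (a : Fin n → (A.hom B X).obj m) (i : Fin n) :
    (A.hom B X).map (λ_ m).hom (A.comp (p i) (hp.lift a)) = a i :=
  congrFun ((hp B m).2 a).choose_spec i

theorem lift_bijective :
    Function.Bijective (hp.lift : (Fin n → (A.hom B X).obj m) → (A.hom B P).obj m) :=
  ⟨fun a b h => funext fun i => by rw [← hp.map_comp_lift a, h, hp.map_comp_lift],
    fun f => ⟨fun i => (A.hom B X).map (λ_ m).hom (A.comp (p i) f), hp.ext fun i => by
      rw [comp_lift, ← Functor.map_comp_apply]
      simp⟩⟩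

theorem lift_map {m' : M} (e : m ⟶ m') (a : Fin n → (A.hom B X).obj m) :
    hp.lift (fun i => (A.hom B X).map e (a i)) = (A.hom B P).map e (hp.lift a) := by
  refine hp.ext fun i => ?_
  simp only [comp_lift, comp_map_right, ← Functor.map_comp_apply]
  simp

theorem lift_comp {B' : C} {m' : M} (a : Fin n → (A.hom B X).obj m) (f : (A.hom B' B).obj m') :
    hp.lift (fun i => A.comp (a i) f) = A.comp (hp.lift a) f := by
  refine hp.ext fun i => ?_
  rw [comp_lift, ← A.assoc, comp_lift, comp_map_left]
  simp only [← Functor.map_comp_apply]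
  simp

include hp in
/-- A functor that preserves one power of an object preserves all isomorphic ones. -/
theorem map_of_map {D : Type v} {A' : GradedCat M D} (F : Fun A A') {Q : C}
    {q : Fin n → (A.hom Q X).obj (𝟙_ M)} (hq : A.IsPower q)
    (hFp : A'.IsPower fun i => (F.map P X).app (𝟙_ M) (p i)) :
    A'.IsPower fun i => (F.map Q X).app (𝟙_ M) (q i) := by
  -- The comparison maps `u = hp.lift q : Q → P` and `v = hq.lift p : P → Q` satisfy `p i ∘ u = q i`
  -- and `q i ∘ v = p i`. Of the two inverse laws only `v ∘ u = 1` is needed: it makes composition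
  -- with `F u` injective.
  have hvu : A.comp (hq.lift p) (hp.lift q) = (A.hom Q Q).map (λ_ _).inv (A.id Q) := by
    refine hq.ext fun i => ?_
    rw [← A.assoc, comp_lift, comp_map_left, comp_lift, comp_map_right,
      comp_id']
    simp only [← Functor.map_comp_apply]
    congr 2
    simp [unitors_inv_equal]
  have hvu' := congrArg ((F.map Q Q).app _) hvu
  rw [NatTrans.naturality_apply, F.map_id, F.map_comp] at hvu'
  have hpu (i : Fin n) := congrArg ((F.map Q X).app _) (hp.comp_lift q i)
  have hqv (i : Fin n) := congrArg ((F.map P X).app _) (hq.comp_lift p i)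
  simp only [F.map_comp, NatTrans.naturality_apply] at hpu hqv
  intro B m
  constructor
  · intro f g h
    have huf : A'.comp ((F.map Q P).app _ (hp.lift q)) f =
        A'.comp ((F.map Q P).app _ (hp.lift q)) g := by
      refine hFp.ext fun i => ?_
      rw [← A'.assoc, ← A'.assoc, hpu, comp_map_left, comp_map_left,
        (map_iso_bijective (A'.hom B (F.obj X)) (λ_ m)).1 (congrFun h i)]
    have := congrArg (A'.comp ((F.map P Q).app _ (hq.lift p))) huf
    rw [← A'.assoc, ← A'.assoc, hvu', comp_map_left, comp_map_left, id_comp', id_comp'] at this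
    simp only [← Functor.map_comp_apply] at this
    refine (map_iso_bijective (A'.hom B (F.obj Q))
      ((λ_ m).symm ≪≫ whiskerRightIso (λ_ (𝟙_ M)).symm m ≪≫ α_ _ _ _)).1 ?_
    simpa using this
  · intro a
    -- The tuple is lifted along `F P` and carried to `F Q` by `F v`; its components are right
    -- because `F (q i) ∘ F v = F (p i)`.
    refine ⟨(A'.hom _ _).map (λ_ m).hom
      (A'.comp ((F.map P Q).app _ (hq.lift p)) (hFp.lift a)), funext fun i => ?_⟩
    dsimp only
    rw [comp_map_right, ← A'.assoc, hqv, comp_map_left]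
    refine (congrArg _ (congrArg _ (congrArg _ (congrArg _ (hFp.comp_lift a i))))).trans ?_
    simp only [← Functor.map_comp_apply]
    simp

end IsPower

end Power

/-! ### Powers in the category of arities -/

theorem arities_hom_ext {n n' : ℕ} {m : M} {f g : ((arities M).hom n n').obj m}
    (h : ∀ i, f.app (𝟙_ M) (arityGen M i) = g.app (𝟙_ M) (arityGen M i)) : f = g :=
  arity_hom_ext h

/-- The morphism of arities given by a map of finite sets. -/
def arityMap {p k : ℕ} (r : Fin k → Fin p) : ((arities M).hom p k).obj (𝟙_ M) :=
  ofPoints (H := tensorRight (𝟙_ M) ⋙ arity M p) fun j => (r j, (λ_ (𝟙_ M)).inv)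

theorem arityMap_app_gen {p k : ℕ} (r : Fin k → Fin p) (j : Fin k) :
    (arityMap r).app (𝟙_ M) (arityGen M j) = (r j, (λ_ (𝟙_ M)).inv) :=
  ofPoints_app_gen _ _

/-- Composition with `arityMap r` reindexes the tuple of values at the generators along `r`, which
reduces powers of arities to a regrouping of finite families. -/
theorem map_comp_arityMap_app_gen {p k b : ℕ} {m : M} (r : Fin k → Fin p)
    (f : ((arities M).hom b p).obj m) (j : Fin k) :
    (((arities M).hom b k).map (λ_ m).hom ((arities M).comp (arityMap r) f)).app (𝟙_ M)
      (arityGen M j) = f.app (𝟙_ M) (arityGen M (r j)) := by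
  change (arity M b).map (𝟙_ M ◁ (λ_ m).hom) ((arity M b).map (α_ (𝟙_ M) (𝟙_ M) m).hom
    (f.app (𝟙_ M ⊗ 𝟙_ M) ((arityMap r).app (𝟙_ M) (arityGen M j)))) = _
  rw [arityMap_app_gen]
  refine (congrArg _ (congrArg _ (arity_app (H := tensorRight m ⋙ arity M b) f _))).trans ?_
  change (arity M b).map _ ((arity M b).map _ ((arity M b).map ((λ_ (𝟙_ M)).inv ▷ m) _)) = _
  simp only [← Functor.map_comp_apply]
  simp

/-- A morphism into `p` is a `p`-tuple of values at generators. A bijection `Fin n × Fin k ≃ Fin p`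
cuts it into `n` blocks of length `k`, and `arityMap (r i)` extracts the `i`-th block. -/
theorem arityMap_isPower {n k p : ℕ} (r : Fin n → Fin k → Fin p)
    (hr : Function.Bijective (Function.uncurry r)) :
    (arities M).IsPower fun i => arityMap (r i) := by
  intro B m
  constructor
  · intro f g h
    refine arities_hom_ext fun x => ?_
    obtain ⟨⟨i, j⟩, rfl⟩ := hr.2 x
    have := congrArg (fun τ => τ.app (𝟙_ M) (arityGen M j)) (congrFun h i)
    exact (map_comp_arityMap_app_gen (r i) f j).symm.trans
      (this.trans (map_comp_arityMap_app_gen (r i) g j))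
  · intro a
    let e := Equiv.ofBijective _ hr
    refine ⟨ofPoints (H := tensorRight m ⋙ arity M B) fun x =>
      NatTrans.app (a (e.symm x).1) (𝟙_ M) (arityGen M (e.symm x).2), funext fun i => ?_⟩
    refine arities_hom_ext fun j => ?_
    refine (map_comp_arityMap_app_gen (r i) _ j).trans ((ofPoints_app_gen _ _).trans ?_)
    rw [show e.symm (r i j) = (i, j) from e.symm_apply_apply (i, j)]

/-- A functor out of the category of arities preserves cotensors if it preserves the chosen
powers `n * k` of the arities `k`. -/
theorem preservesArityCotensors_of_isPower {D : Type w} {B : GradedCat M D}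
    (F : Fun (arities M) B)
    (h : ∀ n k : ℕ, B.IsPower fun i : Fin n => (F.map (n * k) k).app (𝟙_ M)
      (arityMap fun j => finProdFinEquiv (i, j))) : F.PreservesArityCotensors := by
  intro n X P ν hν
  rw [isCotensor_iff_isPower] at hν ⊢
  exact (arityMap_isPower (fun (i : Fin n) (j : Fin X) => finProdFinEquiv (i, j))
    finProdFinEquiv.bijective).map_of_map F hν (h n X)

/-! ### Identity-on-objects functors. -/

@[ext]
theorem IdFun.ext_map {C : Type w} {A B : GradedCat M C} {F G : IdFun A B}
    (h : ∀ X Y, F.map X Y = G.map X Y) : F = G := by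
  cases F
  cases G
  congr
  exact funext fun X => funext fun Y => h X Y

/-- The object maps are literally the same, so the heterogeneous equality of the hom parts is an
equality. Equations between functors thus become equations on hom-presheaves. -/
theorem IdFun.toFun_injective {C : Type w} {A B : GradedCat M C} :
    Function.Injective (IdFun.toFun : IdFun A B → Fun A B) := by
  intro F G h
  refine IdFun.ext_map fun X Y => ?_
  have h' : HEq F.toFun.map G.toFun.map := by rw [h]
  exact congrFun (congrFun (eq_of_heq h') X) Y

/-- Composition of identity-on-objects functors. -/
def IdFun.comp {C : Type w} {A B D : GradedCat M C} (F : IdFun A B) (G : IdFun B D) :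
    IdFun A D where
  map X Y := F.map X Y ≫ G.map X Y
  map_id := (F.toFun.comp G.toFun).map_id
  map_comp := (F.toFun.comp G.toFun).map_comp

end GradedCat

/-! ### Morphisms and isomorphisms of graded Lawvere theories. -/

namespace GLaw

variable {M : Type u} [SmallCategory M] [MonoidalCategory M]

/-- The morphism of Lawvere theories given by an identity-on-objects functor. -/
def Hom.ofIdFun {L L' : GLaw M} (G : GradedCat.IdFun L.cat L'.cat)
    (h : ∀ (X Y : ℕ) (m : M) (f : ((GradedCat.arities M).hom X Y).obj m),
      (G.map X Y).app m ((L.J.map X Y).app m f) = (L'.J.map X Y).app m f) : L ⟶ L' where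
  functor := G.toFun
  comm := by
    change (L.J.comp G).toFun = L'.J.toFun
    congr 1
    ext X Y m f
    exact h X Y m f

/-- Since `J` and `J'` are the identity on objects, `F J = J'` forces `F` to be so too. -/
theorem Hom.exists_idFun {L L' : GLaw M} (F : L ⟶ L') :
    ∃ (G : GradedCat.IdFun L.cat L'.cat) (h : ∀ (X Y : ℕ) (m : M)
      (f : ((GradedCat.arities M).hom X Y).obj m),
      (G.map X Y).app m ((L.J.map X Y).app m f) = (L'.J.map X Y).app m f),
      F = Hom.ofIdFun G h := by
  obtain ⟨⟨obj, map, map_id, map_comp⟩, comm⟩ := F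
  obtain rfl : obj = fun X => X := congrArg GradedCat.Fun.obj comm
  have hJ : L.J.comp ⟨map, map_id, map_comp⟩ = L'.J :=
    GradedCat.IdFun.toFun_injective comm
  exact ⟨⟨map, map_id, map_comp⟩, fun X Y m f => by rw [← hJ]; rfl, rfl⟩

/-- The inverses on hom-presheaves automatically preserve identities and composition and are
compatible with the `J`s. -/
theorem Hom.ofIdFun_isIso {L L' : GLaw M} (G : GradedCat.IdFun L.cat L'.cat) (h)
    (hG : ∀ X Y m, Function.Bijective ((G.map X Y).app m)) :
    IsIso (Hom.ofIdFun (L := L) (L' := L') G h) := by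
  have (X Y : ℕ) : IsIso (G.map X Y) := by
    have (m : M) : IsIso ((G.map X Y).app m) := (isIso_iff_bijective _).2 (hG X Y m)
    exact NatIso.isIso_of_isIso_app _
  have hinv (X Y : ℕ) (m : M) (f) : (G.map X Y).app m ((inv (G.map X Y)).app m f) = f := by
    rw [← NatTrans.comp_app_apply, IsIso.inv_hom_id]; rfl
  have hinv' (X Y : ℕ) (m : M) (f) : (inv (G.map X Y)).app m ((G.map X Y).app m f) = f := by
    rw [← NatTrans.comp_app_apply, IsIso.hom_inv_id]; rfl
  let G' : GradedCat.IdFun L'.cat L.cat :=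
    { map := fun X Y => inv (G.map X Y)
      map_id := fun X => by rw [← G.map_id, hinv']
      map_comp := fun g f => (hG _ _ _).1 (by rw [hinv, G.map_comp, hinv, hinv]) }
  refine ⟨Hom.ofIdFun G' fun X Y m f => by rw [← h]; exact hinv' _ _ _ _, ?_, ?_⟩
  · refine Hom.ext ?_
    change (G.comp G').toFun = GradedCat.IdFun.toFun
      ⟨fun X Y => 𝟙 (L.cat.hom X Y), fun _ => rfl, fun _ _ => rfl⟩
    congr 1
    exact GradedCat.IdFun.ext_map fun X Y => IsIso.hom_inv_id (G.map X Y)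
  · refine Hom.ext ?_
    change (G'.comp G).toFun = GradedCat.IdFun.toFun
      ⟨fun X Y => 𝟙 (L'.cat.hom X Y), fun _ => rfl, fun _ _ => rfl⟩
    congr 1
    exact GradedCat.IdFun.ext_map fun X Y => IsIso.inv_hom_id (G.map X Y)

end GLaw

end Graded

namespace Graded

/-! ### The Lawvere theory of an algebraic theory. -/

namespace Theory

variable {M : Type u} [SmallCategory M] [MonoidalCategory M]

/-- The `n`-th power of a presheaf. -/
abbrev presheafPow (F : M ⥤ Type u) (n : ℕ) : M ⥤ Type u where
  obj m := Fin n → F.obj m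
  map e := TypeCat.ofHom fun a i => F.map e (a i)
  map_id m := by
    ext a i
    simp
  map_comp e e' := by
    ext a i
    simp

variable [IsStrictMonoidal M]

theorem evalCls_map_map {T : Theory M} {A : M ⥤ Type v} {I : Interp T.sig A} (hI : T.IsModel I)
    {X : Type w} {k k' m m' : M} (e : m ⟶ m') (e' : k ⟶ k') (a : X → A.obj k)
    (c : (T.free X).obj m) :
    evalCls hI (fun x => A.map e' (a x)) ((T.free X).map e c) =
      A.map (e ⊗ₘ e') (evalCls hI a c) := by
  rw [evalCls_map, evalCls_natural, ← Functor.map_comp_apply, tensorHom_def']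

theorem map_evalCls_vars {T : Theory M} {A : M ⥤ Type v} {I : Interp T.sig A}
    (hI : T.IsModel I) {X : Type w} {k : M} (a : X → A.obj k) (x : X) :
    A.map (λ_ k).hom (evalCls hI a (T.vars X x)) = a x := by
  rw [evalCls_vars, ← Functor.map_comp_apply, Iso.inv_hom_id, Functor.map_id_apply]

theorem map_evalCls_evalCls {T : Theory M} {A : M ⥤ Type v} {I : Interp T.sig A}
    (hI : T.IsModel I) {X : Type w} {Y : Type*} {j k m : M} (b : X → A.obj k)
    (a : Y → (T.free X).obj j) (c : (T.free Y).obj m) :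
    A.map (α_ m j k).hom (evalCls hI b (evalCls (T.freeInterp_isModel X) a c)) =
      evalCls hI (fun y => evalCls hI b (a y)) c := by
  rw [evalCls_evalCls, ← Functor.map_comp_apply, Iso.inv_hom_id, Functor.map_id_apply]

/-- The graded category with morphisms `k → n` of grade `m` the `n`-tuples of elements of grade `m`
of the free model on `k` variables, composed by substitution. -/
noncomputable def lawvereCat (T : Theory M) : GradedCat M ℕ where
  hom k n := presheafPow (T.free (Fin k)) n
  id k := T.vars (Fin k)
  comp {X _ _ _ _} g f := fun i => evalCls (T.freeInterp_isModel (Fin X)) f (g i)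
  comp_natural e₁ e₂ g f := funext fun i => evalCls_map_map _ e₁ e₂ f (g i)
  id_comp f := funext fun i => map_evalCls_vars _ f i
  comp_id f := funext fun i => T.evalCls_free_vars (f i)
  assoc h g f := funext fun i => map_evalCls_evalCls _ f g (h i)

theorem lawvereCat_comp_apply (T : Theory M) {k l n : ℕ} {m₁ m₂ : M}
    (g : (T.lawvereCat.hom l n).obj m₁) (f : (T.lawvereCat.hom k l).obj m₂) (i : Fin n) :
    T.lawvereCat.comp g f i = evalCls (T.freeInterp_isModel (Fin k)) f (g i) := rfl

/-- The natural transformation that sends the generators of an arity to the variables. -/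
def arityVars (T : Theory M) (k : ℕ) : GradedCat.arity M k ⟶ T.free (Fin k) :=
  GradedCat.ofPoints (T.vars (Fin k))

theorem arityVars_app (T : Theory M) {k : ℕ} {m : M} (x : (GradedCat.arity M k).obj m) :
    (T.arityVars k).app m x = (T.free (Fin k)).map x.2 (T.vars (Fin k) x.1) := rfl

/-- The functor from the category of arities to the Lawvere theory of a theory. -/
noncomputable def lawvereJ (T : Theory M) : GradedCat.IdFun (GradedCat.arities M) T.lawvereCat where
  map k n :=
    { app := fun m => TypeCat.ofHom fun τ i => (T.free (Fin k)).map (λ_ m).hom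
        ((T.arityVars k).app (𝟙_ M ⊗ m)
          (NatTrans.app τ (𝟙_ M) (GradedCat.arityGen M i)))
      naturality := fun m m' e => by
        ext τ
        funext i
        change (T.free (Fin k)).map (λ_ m').hom ((T.arityVars k).app (𝟙_ M ⊗ m')
          ((GradedCat.arity M k).map (𝟙_ M ◁ e)
            (NatTrans.app τ (𝟙_ M) (GradedCat.arityGen M i)))) =
          (T.free (Fin k)).map e ((T.free (Fin k)).map (λ_ m).hom
            ((T.arityVars k).app (𝟙_ M ⊗ m)
              (NatTrans.app τ (𝟙_ M) (GradedCat.arityGen M i))))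
        rw [NatTrans.naturality_apply]
        simp only [← Functor.map_comp_apply]
        simp }
  map_id k := by
    funext i
    change (T.free (Fin k)).map (λ_ (𝟙_ M)).hom ((T.arityVars k).app (𝟙_ M ⊗ 𝟙_ M)
      ((GradedCat.arity M k).map (ρ_ (𝟙_ M)).inv (GradedCat.arityGen M i))) = T.vars (Fin k) i
    rw [NatTrans.naturality_apply, ← Functor.map_comp_apply, arityVars,
      GradedCat.ofPoints_app_gen]
    simp [unitors_equal]
  map_comp {X Y Z m₁ m₂} g f := by
    funext i
    rw [lawvereCat_comp_apply]
    change (T.free (Fin X)).map (λ_ (m₁ ⊗ m₂)).hom ((T.arityVars X).app _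
      ((GradedCat.arity M X).map (α_ (𝟙_ M) m₁ m₂).hom (NatTrans.app f (𝟙_ M ⊗ m₁)
        (NatTrans.app g (𝟙_ M) (GradedCat.arityGen M i))))) =
      evalCls _ (fun j => (T.free (Fin X)).map (λ_ m₂).hom ((T.arityVars X).app (𝟙_ M ⊗ m₂)
        (NatTrans.app f (𝟙_ M) (GradedCat.arityGen M j))))
        ((T.free (Fin Y)).map (λ_ m₁).hom ((T.arityVars Y).app (𝟙_ M ⊗ m₁)
          (NatTrans.app g (𝟙_ M) (GradedCat.arityGen M i))))
    generalize (NatTrans.app g (𝟙_ M) (GradedCat.arityGen M i)) = y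
    change (GradedCat.arity M Y).obj (𝟙_ M ⊗ m₁) at y
    -- An element `y` of an arity is a generator transported along `y.2`, so naturality gives `f` at
    -- `y` from its value at that generator. On the other side, substitution into a coerced variable
    -- does the same.
    have h : NatTrans.app f (𝟙_ M ⊗ m₁) y = (GradedCat.arity M X).map (y.2 ▷ m₂)
        (NatTrans.app f (𝟙_ M) (GradedCat.arityGen M y.1)) :=
      GradedCat.arity_app (H := tensorRight m₂ ⋙ GradedCat.arity M X) f y
    refine (congrArg (fun z => (T.free (Fin X)).map (λ_ (m₁ ⊗ m₂)).hom ((T.arityVars X).app _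
      ((GradedCat.arity M X).map (α_ (𝟙_ M) m₁ m₂).hom z))) h).trans ?_
    dsimp only
    rw [NatTrans.naturality_apply, NatTrans.naturality_apply, arityVars_app T y,
      evalCls_map, evalCls_map, evalCls_vars]
    simp only [← Functor.map_comp_apply]
    congr 2
    simp

theorem lawvereJ_app (T : Theory M) {k n : ℕ} {m : M}
    (τ : ((GradedCat.arities M).hom k n).obj m) (i : Fin n) :
    (T.lawvereJ.map k n).app m τ i = (T.free (Fin k)).map (λ_ m).hom
      ((T.arityVars k).app (𝟙_ M ⊗ m) (NatTrans.app τ (𝟙_ M) (GradedCat.arityGen M i))) := rfl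

/-- In particular, projections of arities go to variables; this yields both preservation of powers
and the fact that a functor over `N_M` fixes the variables. -/
theorem lawvereJ_arityMap (T : Theory M) {p k : ℕ} (r : Fin k → Fin p) :
    (T.lawvereJ.map p k).app (𝟙_ M) (GradedCat.arityMap r) = fun j => T.vars (Fin p) (r j) := by
  funext j
  refine (T.lawvereJ_app _ j).trans ?_
  refine (congrArg (fun z => (T.free (Fin p)).map (λ_ (𝟙_ M)).hom ((T.arityVars p).app _ z))
    (GradedCat.arityMap_app_gen r j)).trans ?_
  change (T.free (Fin p)).map _ ((T.free (Fin p)).map (λ_ (𝟙_ M)).inv (T.vars (Fin p) (r j))) = _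
  rw [← Functor.map_comp_apply, Iso.inv_hom_id, Functor.map_id_apply]

/-- Substituting a tuple into variables selects its entries, so the claim is again the regrouping of
a `p`-tuple into `n` blocks of length `k`. -/
theorem lawvereCat_isPower (T : Theory M) {n k p : ℕ} (r : Fin n → Fin k → Fin p)
    (hr : Function.Bijective (Function.uncurry r)) :
    T.lawvereCat.IsPower (P := p) (X := k) fun i j => T.vars (Fin p) (r i j) := by
  have h (B : ℕ) (m : M) (f : (T.lawvereCat.hom B p).obj m) (i : Fin n) :
      (T.lawvereCat.hom B k).map (λ_ m).hom
        (T.lawvereCat.comp (Y := p) (Z := k) (fun j => T.vars (Fin p) (r i j)) f) =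
          fun j => f (r i j) :=
    funext fun j => map_evalCls_vars (T.freeInterp_isModel (Fin B)) f (r i j)
  intro B m
  simp only [h]
  constructor
  · intro f g hfg
    funext x
    obtain ⟨⟨i, j⟩, rfl⟩ := hr.2 x
    exact congrFun (congrFun hfg i) j
  · intro a
    let e := Equiv.ofBijective _ hr
    refine ⟨fun x => a (e.symm x).1 (e.symm x).2, funext fun i => funext fun j => ?_⟩
    dsimp only
    rw [show e.symm (r i j) = (i, j) from e.symm_apply_apply (i, j)]

/-- The graded Lawvere theory of a graded algebraic theory. -/
noncomputable def lawvere (T : Theory M) : GLaw M where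
  cat := T.lawvereCat
  hasCotensors n k := ⟨n * k, _, (T.lawvereCat_isPower (fun i j => finProdFinEquiv (i, j))
    finProdFinEquiv.bijective).isCotensor⟩
  J := T.lawvereJ
  preserves := by
    refine GradedCat.preservesArityCotensors_of_isPower _ fun n k => ?_
    change T.lawvereCat.IsPower fun i : Fin n => (T.lawvereJ.map (n * k) k).app (𝟙_ M)
      (GradedCat.arityMap fun j => finProdFinEquiv (i, j))
    simp only [lawvereJ_arityMap]
    exact T.lawvereCat_isPower (fun i j => finProdFinEquiv (i, j)) finProdFinEquiv.bijective

/-! ### Functoriality and faithfulness. -/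

namespace Hom

variable {T T' T'' : Theory M} (φ : Hom T T')

theorem onFree_map {n : ℕ} {m m' : M} (e : m ⟶ m') (c : (T.free (Fin n)).obj m) :
    φ.onFree ((T.free (Fin n)).map e c) = (T'.free (Fin n)).map e (φ.onFree c) := by
  simp only [onFree, evalCls_map, ← Functor.map_comp_apply]
  simp

theorem onFree_vars {n : ℕ} (i : Fin n) : φ.onFree (T.vars (Fin n) i) = T'.vars (Fin n) i := by
  rw [onFree, evalCls_vars, ← Functor.map_comp_apply, ← unitors_equal, Iso.inv_hom_id,
    Functor.map_id_apply]

/-- The extension of `φ` respects substitution, because both sides interpret `c` in the free model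
of `T'` pulled back along `φ`. This is preservation of composition for `lawvereFun`. -/
theorem onFree_evalCls {n l : ℕ} {m k : M} (a : Fin l → (T.free (Fin n)).obj k)
    (c : (T.free (Fin l)).obj m) :
    φ.onFree (evalCls (T.freeInterp_isModel (Fin n)) a c) =
      evalCls (T'.freeInterp_isModel (Fin n)) (fun i => φ.onFree (a i)) (φ.onFree c) := by
  rw [evalCls_onFree]
  simp only [onFree]
  rw [evalCls_evalCls, evalCls_natural, ← Functor.map_comp_apply]
  rw [show (α_ m k (𝟙_ M)).inv ≫ (ρ_ (m ⊗ k)).hom = m ◁ (ρ_ k).hom by simp]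

theorem onFree_generic {n : ℕ} {m : M} (f : T.sig n m) :
    φ.onFree (T.cls (generic T f)) = φ.app f := by
  rw [onFree, evalCls_generic]
  exact T'.evalCls_free_vars _

theorem id_onFree {n : ℕ} {m : M} (c : (T.free (Fin n)).obj m) : (Hom.id T).onFree c = c := by
  refine Eq.trans ?_ (T.evalCls_free_vars c)
  refine congrArg _ (evalCls_congr _ _ ?_ _ _)
  ext n m f j a
  exact evalCls_generic (T.freeInterp_isModel _) f a

theorem comp_onFree (ψ : Hom T' T'') {n : ℕ} {m : M} (c : (T.free (Fin n)).obj m) :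
    (φ.comp ψ).onFree c = ψ.onFree (φ.onFree c) := by
  refine congrArg _ (Eq.trans ?_ (φ.evalCls_onFree (ψ.isModel n) _ c).symm)
  refine evalCls_congr _ _ ?_ _ _
  ext n m f j a
  exact ψ.evalCls_onFree (T''.freeInterp_isModel _) a (φ.app f)

/-- The functor between Lawvere categories induced by a morphism of theories. -/
noncomputable def lawvereFun : GradedCat.IdFun T.lawvereCat T'.lawvereCat where
  map k n :=
    { app := fun m => TypeCat.ofHom fun f i => φ.onFree (f i)
      naturality := fun m m' e => by
        ext f
        funext i
        exact φ.onFree_map e (f i) }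
  map_id k := funext fun i => φ.onFree_vars i
  map_comp g f := funext fun i => φ.onFree_evalCls f (g i)

/-- The morphism of Lawvere theories induced by a morphism of theories. -/
noncomputable def lawvere : T.lawvere ⟶ T'.lawvere :=
  GLaw.Hom.ofIdFun φ.lawvereFun fun X Y m f => by
    funext i
    change φ.onFree ((T.lawvereJ.map X Y).app m f i) = (T'.lawvereJ.map X Y).app m f i
    rw [lawvereJ_app, lawvereJ_app, arityVars_app, arityVars_app, onFree_map, onFree_map,
      onFree_vars]

end Hom

/-- The functor that sends a graded algebraic theory to its Lawvere theory. -/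
noncomputable def lawvereFunctor (M : Type u) [SmallCategory M] [MonoidalCategory M]
    [IsStrictMonoidal M] : GS M ⥤ GLaw M where
  obj T := T.lawvere
  map φ := Hom.lawvere φ
  map_id T := by
    refine GLaw.Hom.ext ?_
    change (Hom.id T).lawvereFun.toFun = GradedCat.IdFun.toFun
      ⟨fun X Y => 𝟙 (T.lawvereCat.hom X Y), fun _ => rfl, fun _ _ => rfl⟩
    congr 1
    ext X Y m f
    funext i
    exact Hom.id_onFree (f i)
  map_comp {T T' T''} φ ψ := by
    refine GLaw.Hom.ext ?_
    change (Hom.comp φ ψ).lawvereFun.toFun =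
      ((Hom.lawvereFun φ).comp (Hom.lawvereFun ψ)).toFun
    congr 1
    ext X Y m f
    funext i
    exact Hom.comp_onFree φ ψ (f i)

/-- `φ f` is read off from the action on morphisms `n → 1`, at the generic term of `f`. -/
instance : (lawvereFunctor M).Faithful where
  map_injective {T T'} φ ψ h := by
    have h' : Hom.lawvereFun φ = Hom.lawvereFun ψ :=
      GradedCat.IdFun.toFun_injective (congrArg GLaw.Hom.functor h)
    refine Hom.ext (funext fun n => funext fun m => funext fun f => ?_)
    rw [← Hom.onFree_generic φ, ← Hom.onFree_generic ψ]
    have := congrArg (fun F => (F.map n 1).app m fun _ => T.cls (Hom.generic T f)) h'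
    exact congrFun this 0

end Theory

end Graded

namespace Graded

namespace Theory

variable {M : Type u} [SmallCategory M] [MonoidalCategory M] [IsStrictMonoidal M]

/-! ### Fullness. -/

section Full

variable {T T' : Theory M} (G : GradedCat.IdFun T.lawvereCat T'.lawvereCat)

/-- The action on free models of a functor between Lawvere categories. -/
def freeMap {n : ℕ} {m : M} (c : (T.free (Fin n)).obj m) : (T'.free (Fin n)).obj m :=
  (G.map n 1).app m (fun _ => c) 0

theorem freeMap_map {n : ℕ} {m m' : M} (e : m ⟶ m') (c : (T.free (Fin n)).obj m) :
    freeMap G ((T.free (Fin n)).map e c) = (T'.free (Fin n)).map e (freeMap G c) :=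
  congrFun (NatTrans.naturality_apply (G.map n 1) e fun _ => c) 0

variable (hG : ∀ (X Y : ℕ) (m : M) (f : ((GradedCat.arities M).hom X Y).obj m),
  (G.map X Y).app m ((T.lawvereJ.map X Y).app m f) = (T'.lawvereJ.map X Y).app m f)

include hG

theorem map_vars {n k : ℕ} (r : Fin k → Fin n) :
    (G.map n k).app (𝟙_ M) (fun j => T.vars (Fin n) (r j)) = fun j => T'.vars (Fin n) (r j) := by
  rw [← lawvereJ_arityMap, ← lawvereJ_arityMap]
  exact hG _ _ _ _

theorem freeMap_vars {n : ℕ} (i : Fin n) :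
    freeMap G (T.vars (Fin n) i) = T'.vars (Fin n) i :=
  congrFun (map_vars G hG fun _ : Fin 1 => i) 0

/-- The `i`-th component of a tuple is its composite with the `i`-th variable, and `G` preserves
composition and fixes variables. -/
theorem map_app_eq_freeMap {k n : ℕ} {m : M} (f : (T.lawvereCat.hom k n).obj m) :
    (G.map k n).app m f = fun i => freeMap G (f i) := by
  funext i
  have key (U : Theory M) (g : (U.lawvereCat.hom k n).obj m) :
      (U.lawvereCat.hom k 1).map (λ_ m).hom
        (U.lawvereCat.comp (Y := n) (Z := 1) (fun _ => U.vars (Fin n) i) g) = fun _ => g i :=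
    funext fun _ => map_evalCls_vars (U.freeInterp_isModel (Fin k)) g i
  have h := (NatTrans.naturality_apply (G.map k 1) (λ_ m).hom _).trans
    (congrArg _ (G.map_comp (X := k) (Y := n) (Z := 1) (fun _ => T.vars (Fin n) i) f))
  rw [key T f, map_vars G hG, key T'] at h
  exact (congrFun h 0).symm

/-- Substitution is composition of a 1-tuple with a tuple, and `G` acts on the latter componentwise.
-/
theorem freeMap_evalCls {k l : ℕ} {m m' : M} (a : Fin l → (T.free (Fin k)).obj m)
    (c : (T.free (Fin l)).obj m') :
    freeMap G (evalCls (T.freeInterp_isModel (Fin k)) a c) =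
      evalCls (T'.freeInterp_isModel (Fin k)) (fun i => freeMap G (a i)) (freeMap G c) := by
  have h := congrFun (G.map_comp (X := k) (Y := l) (Z := 1) (fun _ => c) a) 0
  rw [map_app_eq_freeMap G hG a] at h
  exact h

/-- Induction on `s`. In the operation case, `f (t₁, …)` is the generic term of `f` with the `tᵢ`
substituted, and `freeMap` respects substitution. -/
theorem pullback_eval_freeMap {n k : ℕ} {m j : M} (a : Fin n → (T'.free (Fin k)).obj j)
    (s : Term T.sig (Fin n) m) :
    (pullback (T'.freeInterp_isModel (Fin k)) fun _ _ f =>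
      freeMap G (T.cls (Hom.generic T f))).eval a s =
        evalCls (T'.freeInterp_isModel (Fin k)) a (freeMap G (T.cls s)) := by
  induction s with
  | var x =>
    change _ = evalCls _ a (freeMap G (T.vars (Fin n) x))
    rw [freeMap_vars G hG]
    rfl
  | coe e t ih => rw [← map_cls, freeMap_map, evalCls_map, ← ih]; rfl
  | @op l m m' f t ih =>
    rw [← freeInterp_op_cls, ← Hom.evalCls_generic (T.freeInterp_isModel (Fin n)),
      freeMap_evalCls G hG, evalCls_evalCls]
    simp only [← ih]
    rfl

/-- The morphism of theories induced by a functor between Lawvere categories. -/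
def homOfIdFun : Hom T T' where
  app _ _ f := freeMap G (T.cls (Hom.generic T f))
  isModel k n m s t h j a := by
    -- The two sides of an axiom have the same class, seen by evaluating them at the variables of
    -- the free model. As `freeMap` acts on classes, the axiom holds in the pulled-back
    -- interpretation.
    have hst : T.cls s = T.cls t := by
      have := (T.freeInterp_isModel (Fin n)) h (T.vars (Fin n))
      have h' := congrArg ((T.free (Fin n)).map (ρ_ m).hom) this
      exact (T.evalCls_free_vars (T.cls s)).symm.trans (h'.trans (T.evalCls_free_vars (T.cls t)))
    rw [pullback_eval_freeMap G hG, pullback_eval_freeMap G hG, hst]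

/-- `pullback_eval_freeMap` at the variables says that the extension of the generic values is
`freeMap`, which determines `G`. -/
theorem lawvereFun_homOfIdFun : (homOfIdFun G hG).lawvereFun = G := by
  refine GradedCat.IdFun.ext_map fun k n => ?_
  ext m f
  change (fun i => (homOfIdFun G hG).onFree (f i)) = (G.map k n).app m f
  rw [map_app_eq_freeMap G hG]
  funext i
  obtain ⟨s, hs⟩ := T.exists_cls (f i)
  rw [← hs]
  exact (congrArg _ (pullback_eval_freeMap G hG (T'.vars (Fin k)) s)).trans
    (T'.evalCls_free_vars _)

end Full

instance : (lawvereFunctor M).Full where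
  map_surjective {T T'} F := by
    obtain ⟨G, hG, rfl⟩ := GLaw.Hom.exists_idFun F
    refine ⟨homOfIdFun (T := T) (T' := T') G hG, GLaw.Hom.ext ?_⟩
    exact congrArg GradedCat.IdFun.toFun (lawvereFun_homOfIdFun (T := T) (T' := T') G hG)

end Theory

/-! ### The theory of all operations of a Lawvere theory. -/

namespace GLaw

variable {M : Type u} [SmallCategory M] [MonoidalCategory M] (L : GLaw M)

/-- The projections `n → 1` of a graded Lawvere theory. -/
def proj (n : ℕ) (i : Fin n) : (L.cat.hom n 1).obj (𝟙_ M) :=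
  (L.J.map n 1).app (𝟙_ M) (GradedCat.arityMap fun _ => i)

/-- Among arities `n` is the `n`-th power of `1`, by `Fin n × Fin 1 ≃ Fin n`, and `J` preserves
cotensors. -/
theorem proj_isPower (n : ℕ) : L.cat.IsPower (L.proj n) := by
  have hr : Function.Bijective (Function.uncurry fun (i : Fin n) (_ : Fin 1) => i) :=
    ⟨fun ⟨_, _⟩ ⟨_, _⟩ h => Prod.ext h (Subsingleton.elim _ _), fun i => ⟨(i, 0), rfl⟩⟩
  have h := L.preserves n 1 n _ (GradedCat.arityMap_isPower (M := M) _ hr).isCotensor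
  rw [GradedCat.isCotensor_iff_isPower] at h
  have e : L.proj n = fun i => (GradedCat.ofPoints (fun i => GradedCat.arityMap fun _ => i) ≫
      L.J.map n 1).app (𝟙_ M) (GradedCat.arityGen M i) := funext fun i =>
    congrArg ((L.J.map n 1).app (𝟙_ M)) (GradedCat.ofPoints_app_gen
      (H := (GradedCat.arities M).hom n 1) (fun i => GradedCat.arityMap fun _ => i) i).symm
  rw [e]
  exact h

/-- The operations of a graded Lawvere theory, as a signature. -/
abbrev sig : Signature M := fun n m => (L.cat.hom n 1).obj m

/-- The interpretation of the operations of a graded Lawvere theory in the presheaf of morphisms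
`k → 1`, by composition. -/
noncomputable def interp (k : ℕ) : Interp L.sig (L.cat.hom k 1) where
  op {n _} f _ a := L.cat.comp (Y := n) f ((L.proj_isPower n).lift a)
  op_natural f _ _ e a := by
    rw [GradedCat.IsPower.lift_map, GradedCat.comp_map_right]

theorem interp_op {k n : ℕ} {m m' : M} (f : L.sig n m) (a : Fin n → (L.cat.hom k 1).obj m') :
    (L.interp k).op f a = L.cat.comp (Y := n) f ((L.proj_isPower n).lift a) := rfl

/-- Precomposition commutes with the interpretation of terms. -/
theorem interp_eval_comp {X : Type w} {k n : ℕ} {m j j' : M} (b : X → (L.cat.hom n 1).obj j)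
    (a : (L.cat.hom k n).obj j') (s : Term L.sig X m) :
    (L.interp k).eval (fun x => L.cat.comp (b x) a) s =
      (L.cat.hom k 1).map (α_ m j j').hom (L.cat.comp ((L.interp n).eval b s) a) := by
  induction s with
  | var x =>
    simp only [Interp.eval, GradedCat.comp_map_left, ← Functor.map_comp_apply]
    congr 2
    simp
  | coe e t ih =>
    simp only [Interp.eval, ih, GradedCat.comp_map_left, ← Functor.map_comp_apply]
    congr 2
    simp
  | op f t ih =>
    simp only [Interp.eval, ih, GradedCat.comp_map_left, interp_op, GradedCat.IsPower.lift_map,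
      GradedCat.IsPower.lift_comp, GradedCat.comp_map_right, ← Functor.map_comp_apply]
    rw [← L.cat.assoc, ← Functor.map_comp_apply]
    congr 2
    simp

/-- The tuple `a` consists of the projections precomposed with its lift, so by `interp_eval_comp`
the value of a term at `a` is determined by its value at the projections. -/
theorem interp_eval {k n : ℕ} {m j : M} (a : Fin n → (L.cat.hom k 1).obj j)
    (s : Term L.sig (Fin n) m) :
    (L.interp k).eval a s = (L.cat.hom k 1).map ((ρ_ m).hom ▷ j)
      (L.cat.comp ((L.interp n).eval (L.proj n) s) ((L.proj_isPower n).lift a)) := by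
  have h := L.interp_eval_comp (L.proj n) ((L.proj_isPower n).lift a) s
  simp only [GradedCat.IsPower.comp_lift, Interp.eval_natural] at h
  -- Each `a i` appears in `h` behind an inverse left unitor; both sides are compared after that
  -- isomorphism, and the triangle identity matches the grades.
  refine (GradedCat.map_iso_bijective (L.cat.hom k 1) (whiskerLeftIso m (λ_ j).symm)).1 ?_
  refine h.trans ?_
  have e : (α_ m (𝟙_ M) j).hom = (ρ_ m).hom ▷ j ≫ m ◁ (λ_ j).inv := by
    rw [← triangle, Category.assoc, ← whiskerLeft_comp]
    simp
  rw [e, Functor.map_comp_apply]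
  rfl

/-- The theory of a graded Lawvere theory: all operations and all equations between them. -/
noncomputable abbrev theory : Theory M where
  sig := L.sig
  eqs n _ := {s | (L.interp n).eval (L.proj n) s.1 = (L.interp n).eval (L.proj n) s.2}

/-- The axioms hold at the projections by definition, hence at every tuple by `interp_eval`. -/
theorem interp_isModel (k : ℕ) : L.theory.IsModel (L.interp k) := by
  intro n m s t h j a
  have h' : (L.interp n).eval (L.proj n) s = (L.interp n).eval (L.proj n) t := h
  exact (L.interp_eval a s).trans (h' ▸ (L.interp_eval a t).symm)

/-! ### Denotations and the comparison with the original Lawvere theory. -/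

variable [IsStrictMonoidal M]

open Theory

/-- The operation denoted by a term of the theory of a graded Lawvere theory. -/
noncomputable def denote {n : ℕ} {m : M} (c : (L.theory.free (Fin n)).obj m) :
    (L.cat.hom n 1).obj m :=
  (L.cat.hom n 1).map (ρ_ m).hom (evalCls (L.interp_isModel n) (L.proj n) c)

theorem denote_map {n : ℕ} {m m' : M} (e : m ⟶ m') (c : (L.theory.free (Fin n)).obj m) :
    L.denote ((L.theory.free (Fin n)).map e c) = (L.cat.hom n 1).map e (L.denote c) := by
  simp only [denote, evalCls_map, ← Functor.map_comp_apply]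
  simp

theorem denote_vars {n : ℕ} (i : Fin n) : L.denote (L.theory.vars (Fin n) i) = L.proj n i := by
  rw [denote, evalCls_vars, ← Functor.map_comp_apply, ← unitors_equal, Iso.inv_hom_id,
    Functor.map_id_apply]

theorem evalCls_interp {k n : ℕ} {m j : M} (a : Fin n → (L.cat.hom k 1).obj j)
    (c : (L.theory.free (Fin n)).obj m) :
    evalCls (L.interp_isModel k) a c =
      L.cat.comp (L.denote c) ((L.proj_isPower n).lift a) := by
  obtain ⟨s, rfl⟩ := L.theory.exists_cls c
  rw [denote, GradedCat.comp_map_left]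
  exact L.interp_eval a s

/-- Substitution of terms becomes composition of operations, which makes `counitFun` a functor. -/
theorem denote_evalCls {k n : ℕ} {m j : M} (a : Fin n → (L.theory.free (Fin k)).obj j)
    (c : (L.theory.free (Fin n)).obj m) :
    L.denote (evalCls (L.theory.freeInterp_isModel (Fin k)) a c) =
      L.cat.comp (L.denote c) ((L.proj_isPower n).lift fun i => L.denote (a i)) := by
  rw [← evalCls_interp]
  simp only [denote]
  rw [evalCls_evalCls, evalCls_natural, ← Functor.map_comp_apply]
  rw [show (α_ m j (𝟙_ M)).inv ≫ (ρ_ (m ⊗ j)).hom = m ◁ (ρ_ j).hom by simp]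

/-- Injective because terms with equal denotations form an axiom; surjective because the generic
term of `f` denotes `f`. -/
theorem denote_bijective (n : ℕ) (m : M) :
    Function.Bijective (L.denote : (L.theory.free (Fin n)).obj m → (L.cat.hom n 1).obj m) := by
  constructor
  · intro c c' h
    obtain ⟨s, rfl⟩ := L.theory.exists_cls c
    obtain ⟨t, rfl⟩ := L.theory.exists_cls c'
    have h' : (s, t) ∈ L.theory.eqs n m :=
      (GradedCat.map_iso_bijective (L.cat.hom n 1) (ρ_ m)).1 h
    have := L.theory.freeInterp_isModel (Fin n) h' (L.theory.vars (Fin n))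
    exact (L.theory.evalCls_free_vars (L.theory.cls s)).symm.trans
      ((congrArg ((L.theory.free (Fin n)).map (ρ_ m).hom) this).trans
        (L.theory.evalCls_free_vars (L.theory.cls t)))
  · intro f
    refine ⟨L.theory.cls (Hom.generic L.theory f), ?_⟩
    rw [denote, Hom.evalCls_generic (L.interp_isModel n) (T := L.theory) f]
    change (L.cat.hom n 1).map (ρ_ m).hom (L.cat.comp f _) = f
    -- The lift of the projections is the identity, so the generic term denotes `f ∘ 1 = f`.
    rw [show (L.proj_isPower n).lift (L.proj n) = L.cat.id n from
      (L.proj_isPower n).ext fun i => by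
        rw [GradedCat.IsPower.comp_lift, GradedCat.comp_id', unitors_inv_equal]]
    exact L.cat.comp_id f

/-- The functor to a graded Lawvere theory from the Lawvere category of its theory. -/
noncomputable def counitFun : GradedCat.IdFun L.theory.lawvereCat L.cat where
  map k n :=
    { app := fun m => TypeCat.ofHom fun f => (L.proj_isPower n).lift fun i => L.denote (f i)
      naturality := fun m m' e => by
        ext f
        change (L.proj_isPower n).lift (fun i => L.denote ((L.theory.free (Fin k)).map e (f i))) =
          (L.cat.hom k n).map e ((L.proj_isPower n).lift fun i => L.denote (f i))
        simp only [denote_map, GradedCat.IsPower.lift_map] }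
  map_id k := by
    change (L.proj_isPower k).lift (fun i => L.denote (L.theory.vars (Fin k) i)) = _
    refine (L.proj_isPower k).ext fun i => ?_
    rw [GradedCat.IsPower.comp_lift, GradedCat.comp_id', unitors_inv_equal, denote_vars]
  map_comp {X Y Z m₁ m₂} g f := by
    change (L.proj_isPower Z).lift (fun i => L.denote
      (evalCls (L.theory.freeInterp_isModel (Fin X)) f (g i))) =
        L.cat.comp ((L.proj_isPower Z).lift fun i => L.denote (g i))
          ((L.proj_isPower Y).lift fun i => L.denote (f i))
    rw [← GradedCat.IsPower.lift_comp]
    exact congrArg _ (funext fun i => L.denote_evalCls f (g i))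

/-- Both sides are images under `L.J` of morphisms of arities, so the equation is checked at the
generator in `N_M`. It gives the compatibility of `counit` with the `J`s. -/
theorem map_comp_proj_J {k n : ℕ} {m : M} (τ : ((GradedCat.arities M).hom k n).obj m)
    (i : Fin n) : (L.cat.hom k 1).map (λ_ m).hom
      (L.cat.comp (L.proj n i) ((L.J.map k n).app m τ)) =
        L.denote ((L.theory.lawvereJ.map k n).app m τ i) := by
  rw [lawvereJ_app, arityVars_app, denote_map, denote_map, denote_vars, proj, ← L.J.map_comp,
    proj, ← NatTrans.naturality_apply, ← NatTrans.naturality_apply, ← NatTrans.naturality_apply]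
  refine congrArg _ (GradedCat.arities_hom_ext fun j => ?_)
  refine (GradedCat.map_comp_arityMap_app_gen _ τ j).trans ?_
  set x : (GradedCat.arity M k).obj (𝟙_ M ⊗ m) := NatTrans.app τ (𝟙_ M) (GradedCat.arityGen M i)
  change x = (GradedCat.arity M k).map (𝟙_ M ◁ (λ_ m).hom) ((GradedCat.arity M k).map (𝟙_ M ◁ x.2)
    ((GradedCat.arityMap fun _ : Fin 1 => x.1).app (𝟙_ M) (GradedCat.arityGen M j)))
  rw [GradedCat.arityMap_app_gen]
  change x = (x.1, ((λ_ (𝟙_ M)).inv ≫ 𝟙_ M ◁ x.2) ≫ 𝟙_ M ◁ (λ_ m).hom)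
  refine Prod.ext rfl ?_
  rw [Category.assoc, ← whiskerLeft_comp, ← leftUnitor_inv_naturality]
  simp

/-- The comparison between the Lawvere theory of the theory of `L` and `L`. -/
noncomputable def counit : L.theory.lawvere ⟶ L :=
  Hom.ofIdFun L.counitFun fun k n m τ => by
    refine (L.proj_isPower n).ext fun i => ?_
    refine (GradedCat.map_iso_bijective (L.cat.hom k 1) (λ_ m)).1 ?_
    exact ((L.proj_isPower n).map_comp_lift _ i).trans (L.map_comp_proj_J τ i).symm

/-- On homs the comparison applies `denote` to each component and then lifts to the power; both maps
are bijective. -/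
theorem counit_isIso : IsIso L.counit :=
  Hom.ofIdFun_isIso (L := L.theory.lawvere) _ _ fun k n m =>
    (L.proj_isPower n).lift_bijective.comp
      (Function.Bijective.piMap fun _ => L.denote_bijective k m)

end GLaw

/-! ### The equivalence. -/

namespace Theory

variable {M : Type u} [SmallCategory M] [MonoidalCategory M] [IsStrictMonoidal M]

instance : (lawvereFunctor M).EssSurj where
  mem_essImage L :=
    have := L.counit_isIso
    ⟨L.theory, ⟨(asIso L.counit : L.theory.lawvere ≅ L)⟩⟩

instance : (lawvereFunctor M).IsEquivalence where

end Theory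

end Graded

theorem mainTheorem1 (M : Type u) [SmallCategory M] [MonoidalCategory M]
    [Graded.IsStrictMonoidal M] : Nonempty (Graded.GS M ≌ Graded.GLaw M) := by
  exact ⟨(Graded.Theory.lawvereFunctor M).asEquivalence⟩
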